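/- Let $\alpha,\beta\in\mathbb R\setminus\{0\}$ and write $Q_u=\begin{pmatrix}0&u\\-u^*&0\end{pmatrix}$, $\sigma_3=\mathrm{diag}(1,-1)$, and $$U_u(\lambda)=-i\lambda\sigma_3+Q_u,\qquad V_u(\lambda)=-2i\lambda^2\sigma_3+\begin{pmatrix} i|u|^2&2\lambda u+iu_x\\-2\lambda u^*+iu_x^*&-i|u|^2\end{pmatrix}.$$ A solution of NLS on the half-line is a classical solution ($u,u_t,u_x,u_{xx}$ exist and are continuous on $t\ge0$, $x\ge0$) of $iu_t+u_{xx}+2|u|^2u=0$ for $t\ge0$, $x\ge 0$; a Lax solution of $u$ at $\lambda$ is a continuous $\psi(t,x)\in\mathbb C^2$ with $\psi_x=U_u(\lambda)\psi$ and $\psi_t=V_u(\lambda)\psi$ for $t\ge0$, $x\ge 0$. Boundary condition. For a function $u$ and a real function $\Omega$ of $t\ge0$ with $\Omega(t)^2=\beta^2-|u(t,0)|^2$, put $$K_{u,\Omega}(t,\lambda)=\frac{1}{(2\lambda-i|\beta|)^2-\alpha^2}\begin{pmatrix}4\lambda^2+4i\lambda\Omega-(\alpha^2+\beta^2)&4i\lambda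 u\\4i\lambda u^*&4\lambda^2-4i\lambda\Omega-(\alpha^2+\beta^2)\end{pmatrix}\Big|_{x=0}.$$ We say that $u$ satisfies the new boundary condition with branch $\Omega$ if $\Omega(t)>0$ for all large $t$ and $$\partial_tK_{u,\Omega}(t,\lambda)=V_u(t,0,-\lambda)K_{u,\Omega}(t,\lambda)-K_{u,\Omega}(t,\lambda)V_u(t,0,\lambda)$$ for all $t\ge0$ and all $\lambda$ with $(2\lambda-i|\beta|)^2\ne\alpha^2$. (In particular $\Omega$ is differentiable. Where $|u(t,0)|<|\beta|$ for all $t\ge 0$, $\Omega$ is the positive square root $\sqrt{\beta^2-|u(t,0)|^2}$.) Let $u[0]$ be a solution of NLS on the half-line which satisfies the new boundary condition with a branch $\Omega[0]$, and whose boundary values lie in $X$, i.e. $u[0](\cdot,0)$, $t\,u[0](\cdot,0)$, $\partial_tu[0](\cdot,0)$, $u[0]_x(\cdot,0)$, $t\,u[0]_x(\cdot,0)$ are in $L^2(\mathbb R_+)$. Let $K_0=K_{u[0],\Omega[0]}$ and $\lambda_0=-\frac{\alpha+i\beta}{2}$. Let $N\ge0$, let $\lambda_1,\dots,\lambda_N\in\mathbb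 C\setminus(\mathbb R\cup i\mathbb R\cup\{\lambda_0,\lambda_0^*,-\lambda_0,-\lambda_0^*\})$ be distinct with $-\lambda_k\neq\lambda_j$ for all $j,k$, and let $\psi_j$ be a Lax solution of $u[0]$ at $\lambda_j$, not identically zero. Assume that there are Lax solutions $\widehat\psi_j$ of $u[0]$ at $\widehat\lambda_j=-\lambda_j$ with $$\widehat\psi_j(t,0)=K_0(t,\lambda_j)\psi_j(t,0)\qquad(t\ge0,\ j=1,\dots,N).$$ Write $(\mu_1,\varphi_1),\dots,(\mu_{2N},\varphi_{2N})$ for $(\lambda_1,\psi_1),(\widehat\lambda_1,\widehat\psi_1),\dots,(\lambda_N,\psi_N),(\widehat\lambda_N,\widehat\psi_N)$, and assume that $\varphi_l^\dagger\varphi_k\neq0$ for all $t,x\ge0$ whenever $\mu_k=\mu_l^*$ (this is void if no two of the $\mu$'s are complex conjugates). The Darboux transformation is defined by $D[0]=\mathbf 1$ and $$D[k](\lambda)=\bigl((\lambda-\mu_k^*)\mathbf 1+(\mu_k^*-\mu_k)P_k\bigr)D[k-1](\lambda),\qquad P_k=\frac{\varphi_k'\varphi_k'^{\dagger}}{\varphi_k'^{\dagger}\varphi_k'},\quad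 \varphi_k'=D[k-1](\mu_k)\varphi_k ,$$ and $\widehat u[N]=u[2N]$ is the $(1,2)$ entry of $Q_{u[0]}-i\sum_{k=1}^{2N}(\mu_k-\mu_k^*)[\sigma_3,P_k]$. Then: 1. the $2N$-fold Darboux transformation is well defined: $\varphi_k'(t,x)\ne0$ for all $k\le 2N$ and $t,x\ge0$; 2. $\widehat u[N]$ is a solution of NLS on the half-line; 3. $\widehat u[N]$ satisfies the same new boundary condition, with the same $\alpha,\beta$: there is a branch $\Omega[N]$, with $\Omega[N]^2=\beta^2-|\widehat u[N](t,0)|^2$ and $\Omega[N]>0$ for large $t$, such that the boundary matrix $K_N=K_{\widehat u[N],\Omega[N]}$, which has the same form and the same signs on the diagonal as $K_0$, satisfies the boundary constraint. Moreover, if $T\ge0$ and $|\widehat u[N](t,0)|<|\beta|$ for all $t\ge T$, then $\Omega[N](t)=\sqrt{\beta^2-|\widehat u[N](t,0)|^2}$ for all $t\ge T$ (so for all $t\ge0$ if $|\widehat u[N](t,0)|<|\beta|$ throughout). -/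

import Mathlib

open Complex Set Filter Topology MeasureTheory
open scoped Matrix ComplexConjugate

noncomputable section

namespace NLSHalfLine

/-- Partial derivative in `t` of a function of `(t, x)` on the closed quadrant
(one-sided at `t = 0`). -/
def dt (u : ℝ → ℝ → ℂ) (t x : ℝ) : ℂ := derivWithin (fun s => u s x) (Ici 0) t

/-- Partial derivative in `x` of a function of `(t, x)` on the closed quadrant
(one-sided at `x = 0`). -/
def dx (u : ℝ → ℝ → ℂ) (t x : ℝ) : ℂ := derivWithin (fun y => u t y) (Ici 0) x

/-- The closed quadrant `t ≥ 0`, `x ≥ 0`. -/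
def quadrant : Set (ℝ × ℝ) := Ici 0 ×ˢ Ici 0

/-- Classical solutions (`C¹` in `t`, `C²` in `x`, up to the boundary) of the focusing NLS equation
`i u_t + u_xx + 2 |u|² u = 0` on the half-line `x ≥ 0`, for times `t ≥ 0`. -/
structure IsNLSSolution (u : ℝ → ℝ → ℂ) : Prop where
  diff_t : ∀ t x : ℝ, 0 ≤ t → 0 ≤ x → DifferentiableWithinAt ℝ (fun s => u s x) (Ici 0) t
  diff_x : ∀ t x : ℝ, 0 ≤ t → 0 ≤ x → DifferentiableWithinAt ℝ (fun y => u t y) (Ici 0) x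
  diff_xx : ∀ t x : ℝ, 0 ≤ t → 0 ≤ x → DifferentiableWithinAt ℝ (fun y => dx u t y) (Ici 0) x
  cont : ContinuousOn (fun p : ℝ × ℝ => u p.1 p.2) quadrant
  cont_t : ContinuousOn (fun p : ℝ × ℝ => dt u p.1 p.2) quadrant
  cont_x : ContinuousOn (fun p : ℝ × ℝ => dx u p.1 p.2) quadrant
  cont_xx : ContinuousOn (fun p : ℝ × ℝ => dx (dx u) p.1 p.2) quadrant
  eqn : ∀ t x : ℝ, 0 ≤ t → 0 ≤ x →
    I * dt u t x + dx (dx u) t x + 2 * (‖u t x‖ : ℂ) ^ 2 * u t x = 0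

/-- The Pauli matrix `diag(1, -1)`. -/
def sigma3 : Matrix (Fin 2) (Fin 2) ℂ := !![1, 0; 0, -1]

/-- The potential `Q` for a value `q` of the solution. -/
def potQ (q : ℂ) : Matrix (Fin 2) (Fin 2) ℂ := !![0, q; -conj q, 0]

/-- The `x` part `U = -i z σ₃ + Q` of the Lax pair, with spectral parameter `z`. -/
def laxU (u : ℝ → ℝ → ℂ) (z : ℂ) (t x : ℝ) : Matrix (Fin 2) (Fin 2) ℂ :=
  (-(I * z)) • sigma3 + potQ (u t x)

/-- The `t` part `V = -2 i z² σ₃ + Q̃` of the Lax pair, with spectral parameter `z`. -/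
def laxV (u : ℝ → ℝ → ℂ) (z : ℂ) (t x : ℝ) : Matrix (Fin 2) (Fin 2) ℂ :=
  (-(2 * I * z ^ 2)) • sigma3 +
    !![I * (‖u t x‖ : ℂ) ^ 2, 2 * z * u t x + I * dx u t x;
       -(2 * z * conj (u t x)) + I * conj (dx u t x), -(I * (‖u t x‖ : ℂ) ^ 2)]

/-- Column solutions, on the closed quadrant, of the Lax system `ψ_x = U ψ`, `ψ_t = V ψ`
of the potential `u` at the spectral parameter `z`. -/
structure IsLaxSolution (u : ℝ → ℝ → ℂ) (z : ℂ) (ψ : ℝ → ℝ → Fin 2 → ℂ) : Prop where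
  cont : ContinuousOn (fun p : ℝ × ℝ => ψ p.1 p.2) quadrant
  x_part : ∀ t x : ℝ, 0 ≤ t → 0 ≤ x →
    HasDerivWithinAt (fun y => ψ t y) (laxU u z t x *ᵥ ψ t x) (Ici 0) x
  t_part : ∀ t x : ℝ, 0 ≤ t → 0 ≤ x →
    HasDerivWithinAt (fun s => ψ s x) (laxV u z t x *ᵥ ψ t x) (Ici 0) t

/-- The boundary matrix with spectral parameter `z`, for the value `q` of the solution at `x = 0`
and the value `om` of the square root `Ω`. -/
def bdryK (α β : ℝ) (q : ℂ) (om : ℝ) (z : ℂ) : Matrix (Fin 2) (Fin 2) ℂ :=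
  ((2 * z - I * (|β| : ℝ)) ^ 2 - (α : ℂ) ^ 2)⁻¹ •
    !![4 * z ^ 2 + 4 * I * z * om - ((α : ℂ) ^ 2 + (β : ℂ) ^ 2), 4 * I * z * q;
       4 * I * z * conj q, 4 * z ^ 2 - 4 * I * z * om - ((α : ℂ) ^ 2 + (β : ℂ) ^ 2)]

/-- The new boundary condition at `x = 0` with parameters `α, β`: the boundary constraint
`K_t = V(-z) K - K V(z)` holds at `x = 0` for every spectral parameter `z` that is not a pole
of `K`, where `K` is the boundary matrix built from `u(t, 0)` and from `Ω`, a real branch of the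
square root of `β² - |u(t, 0)|²` that is positive for large times. The constraint contains the
differentiability of `Ω`, so `Ω` is the nonnegative root up to sign changes at zeros of
`β² - |u(t, 0)|²`. -/
structure IsNewBoundary (α β : ℝ) (u : ℝ → ℝ → ℂ) (Ω : ℝ → ℝ) : Prop where
  sq_eq : ∀ t : ℝ, 0 ≤ t → Ω t ^ 2 = β ^ 2 - ‖u t 0‖ ^ 2
  eventually_pos : ∀ᶠ t in atTop, 0 < Ω t
  constraint : ∀ z : ℂ, (2 * z - I * (|β| : ℝ)) ^ 2 - (α : ℂ) ^ 2 ≠ 0 →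
    ∀ t : ℝ, 0 ≤ t → ∀ i j : Fin 2,
      HasDerivWithinAt (fun s => bdryK α β (u s 0) (Ω s) z i j)
        ((laxV u (-z) t 0 * bdryK α β (u t 0) (Ω t) z
          - bdryK α β (u t 0) (Ω t) z * laxV u z t 0) i j) (Ici 0) t

/-- The boundary values `u(·, 0)` lie in the space `X`: `u(·, 0) ∈ H^{1,1}_t(ℝ₊)` and
`u_x(·, 0) ∈ H^{0,1}_t(ℝ₊)`. -/
structure BoundaryInX (u : ℝ → ℝ → ℂ) : Prop where
  memLp : MemLp (fun t => u t 0) 2 (volume.restrict (Ici 0))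
  memLp_weight : MemLp (fun t : ℝ => (t : ℂ) * u t 0) 2 (volume.restrict (Ici 0))
  memLp_dt : MemLp (fun t => dt u t 0) 2 (volume.restrict (Ici 0))
  memLp_dx : MemLp (fun t => dx u t 0) 2 (volume.restrict (Ici 0))
  memLp_dx_weight : MemLp (fun t : ℝ => (t : ℂ) * dx u t 0) 2 (volume.restrict (Ici 0))

/-- The orthogonal projector `v v† / (v† v)` onto the line spanned by `v`. -/
def lineProj (v : Fin 2 → ℂ) : Matrix (Fin 2) (Fin 2) ℂ :=
  (star v ⬝ᵥ v)⁻¹ • Matrix.vecMulVec v (star v)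

/-- The `n`-fold dressing matrix `D[n]` at the spectral parameter `z` for the parameters
`μ 0, μ 1, …` and the values `φ 0, φ 1, …` (at one point `(t, x)`) of the Lax solutions:
`D[n+1](z) = ((z - μₙ*) 1 + (μₙ* - μₙ) P) D[n](z)`, where `P` is the projector onto the line of
the dressed vector `D[n](μₙ) φₙ`. -/
def dressD (μ : ℕ → ℂ) (φ : ℕ → Fin 2 → ℂ) : ℕ → ℂ → Matrix (Fin 2) (Fin 2) ℂ
  | 0, _ => 1
  | n + 1, z =>
    ((z - conj (μ n)) • (1 : Matrix (Fin 2) (Fin 2) ℂ)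
      + (conj (μ n) - μ n) • lineProj (dressD μ φ n (μ n) *ᵥ φ n)) * dressD μ φ n z

/-- The dressed vector `D[n](μₙ) φₙ`. -/
def dressVec (μ : ℕ → ℂ) (φ : ℕ → Fin 2 → ℂ) (n : ℕ) : Fin 2 → ℂ :=
  dressD μ φ n (μ n) *ᵥ φ n

/-- The dressed potential
`Q[n] = Q[0] - i ∑_{k < n} (μₖ - μₖ*) [σ₃, Pₖ]`, from the value `q` of the seed solution. -/
def dressQ (μ : ℕ → ℂ) (φ : ℕ → Fin 2 → ℂ) (n : ℕ) (q : ℂ) : Matrix (Fin 2) (Fin 2) ℂ :=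
  potQ q - I • ∑ k ∈ Finset.range n, (μ k - conj (μ k)) •
    (sigma3 * lineProj (dressVec μ φ k) - lineProj (dressVec μ φ k) * sigma3)

/-- The dressed solution `u[n]`: the `(1,2)` entry of `Q[n]`. -/
def dressU (u : ℝ → ℝ → ℂ) (μ : ℕ → ℂ) (φ : ℕ → ℝ → ℝ → Fin 2 → ℂ) (n : ℕ) (t x : ℝ) : ℂ :=
  dressQ μ (fun k => φ k t x) n (u t x) 0 1

/-- The spectral parameters `λ₀, -λ₀, λ₁, -λ₁, …` (indices start at `0`). -/
def pairParam (lam : ℕ → ℂ) (k : ℕ) : ℂ := if Even k then lam (k / 2) else -lam (k / 2)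

/-- The Lax solutions `ψ₀, ψ̂₀, ψ₁, ψ̂₁, …` (indices start at `0`). -/
def pairSol (ψ ψhat : ℕ → ℝ → ℝ → Fin 2 → ℂ) (k : ℕ) : ℝ → ℝ → Fin 2 → ℂ :=
  if Even k then ψ (k / 2) else ψhat (k / 2)

/-- The exceptional spectral parameter `-(α + iβ)/2`. -/
def specialParam (α β : ℝ) : ℂ := -((α : ℂ) + I * β) / 2

end NLSHalfLine

end

/-!
The dressed solution is produced by `2N` elementary Darboux transformations. One such step, with a
Lax solution `φ` at the parameter `m` and the projector `P` onto the line of `φ`, replaces `u` by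
`u - 2i (m - m*) P₁₂`. The derivatives of `P` are polynomials in `u`, `u_x` and the entries of `P`,
so the transform is a classical solution (`isNLSSolution_darbouxU`), and `F = (z - m*) + (m* - m) P`
satisfies `F_x = U' F - F U`, `F_t = V' F - F V`, so it carries Lax solutions to Lax solutions
(`IsLaxSolution.darbouxF_mulVec`). The dressed vectors do not vanish, even for conjugate parameters,
by the unitarity relation `D(z*)† D(z) = ∏ (z - μ_k) (z - μ_k*)` (`dressD_mulVec_ne_zero`).

At the boundary write the numerator of `K` as `L(z) = (4 z² - c) 1 + 4 i z M` with `c = α² + β²` and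
`M² = β² 1`; the boundary constraint is an evolution equation for `M`. Dressing by one pair
`(l, ψ), (-l, ψ̂)` with Darboux matrix `G(z)` gives `L'(z) G(z) = G(-z) L(z)`, where
`L'(z) = (4 z² - c) 1 + 4 i z M'` and `M' = M - 2i (l - l*) (P₀ - P₁)` (`bdryL_pairM_mul`): the
difference of the two sides is `z (A + z B)`, and its zeros at `l, l*, -l, -l*`, on the vectors that
define the Darboux matrices and on their orthogonal complements, force `A = B = 0`. Since
`L(-z) L(z)` is scalar, the relation gives `M'² = β² 1`; differentiating it in `t` at the single
value `z = 1` gives the evolution equation of `M'`; and applied to the remaining solutions it shows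
that they are still paired by the new boundary matrix. Induction over the pairs therefore needs no
information on several pairs at once.

There remains the sign of `Ω` for large times. The boundary values of the seed are integrable and
tend to zero, so the line of each Lax solution at `x = 0` converges to a coordinate axis: the
diagonal entry of its projector solves an integrable perturbation of a logistic equation
(`exists_asympDir`). The boundary matrix becomes diagonal, hence both members of a pair have the
same asymptotic direction, `P₀ - P₁ → 0`, and the limits `u → 0`, `Ω → |β|` pass to the transform
(`BdryState.pair`).
-/

noncomputable section

-- The entrywise matrix computations share one list of rewriting rules.
set_option linter.unusedSimpArgs false

namespace NLSHalfLine

/-! ### Line projectors and elementary Darboux matrices -/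

lemma lineProj_apply (v : Fin 2 → ℂ) (i j : Fin 2) :
    lineProj v i j = (star v ⬝ᵥ v)⁻¹ * (v i * conj (v j)) := by
  simp [lineProj, Matrix.vecMulVec_apply]

open scoped ComplexOrder in
lemma star_dotProduct_self_ne_zero {v : Fin 2 → ℂ} (hv : v ≠ 0) : star v ⬝ᵥ v ≠ 0 := by
  rwa [ne_eq, dotProduct_star_self_eq_zero]

lemma star_star_dotProduct (v w : Fin 2 → ℂ) : star (star v ⬝ᵥ w) = star w ⬝ᵥ v := by
  rw [Matrix.star_dotProduct, star_star, dotProduct_comm]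

lemma lineProj_mulVec (v x : Fin 2 → ℂ) :
    lineProj v *ᵥ x = ((star v ⬝ᵥ v)⁻¹ * (star v ⬝ᵥ x)) • v := by
  rw [lineProj, Matrix.smul_mulVec, Matrix.vecMulVec_mulVec, op_smul_eq_smul, smul_smul]

lemma lineProj_mulVec_self (v : Fin 2 → ℂ) : lineProj v *ᵥ v = v := by
  by_cases hv : v = 0
  · simp [hv]
  · rw [lineProj_mulVec, inv_mul_cancel₀ (star_dotProduct_self_ne_zero hv), one_smul]

lemma lineProj_mul_self (v : Fin 2 → ℂ) : lineProj v * lineProj v = lineProj v := by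
  by_cases hv : v = 0
  · simp [hv, lineProj]
  · conv_lhs => rw [lineProj]
    rw [Matrix.smul_mul, Matrix.mul_smul, Matrix.vecMulVec_mul_vecMulVec, lineProj,
      Matrix.vecMulVec_smul, smul_smul, smul_smul]
    congr 1
    field_simp [star_dotProduct_self_ne_zero hv]

lemma conjTranspose_lineProj (v : Fin 2 → ℂ) : (lineProj v)ᴴ = lineProj v := by
  rw [lineProj, Matrix.conjTranspose_smul, Matrix.conjTranspose_vecMulVec, star_star, star_inv₀,
    star_star_dotProduct]

lemma lineProj_one_zero (v : Fin 2 → ℂ) : lineProj v 1 0 = conj (lineProj v 0 1) :=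
  (congrFun (congrFun (conjTranspose_lineProj v) 1) 0).symm

lemma conj_lineProj_diag (v : Fin 2 → ℂ) (i : Fin 2) : conj (lineProj v i i) = lineProj v i i :=
  congrFun (congrFun (conjTranspose_lineProj v) i) i

lemma lineProj_one_one {v : Fin 2 → ℂ} (hv : v ≠ 0) : lineProj v 1 1 = 1 - lineProj v 0 0 := by
  have h := star_dotProduct_self_ne_zero hv
  rw [lineProj_apply, lineProj_apply]
  field_simp
  simp [dotProduct, Fin.sum_univ_two]
  ring

/-- The rank one relation between the entries of a line projector. -/
lemma lineProj_normSq_offDiag (v : Fin 2 → ℂ) :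
    lineProj v 0 1 * conj (lineProj v 0 1) = lineProj v 0 0 - lineProj v 0 0 ^ 2 := by
  have h := congrFun (congrFun (lineProj_mul_self v) 0) 0
  rw [Matrix.mul_apply, Fin.sum_univ_two, lineProj_one_zero] at h
  linear_combination h

lemma lineProj_smul {c : ℂ} (hc : c ≠ 0) (v : Fin 2 → ℂ) : lineProj (c • v) = lineProj v := by
  ext i j
  have hc' : conj c ≠ 0 := by simpa using hc
  by_cases hv : v = 0
  · simp [hv]
  have h := star_dotProduct_self_ne_zero hv
  simp only [lineProj_apply, star_smul, smul_dotProduct, dotProduct_smul, Pi.smul_apply,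
    smul_eq_mul, map_mul, star_def]
  field_simp

/-- The projector onto the image of a line under a matrix, in terms of the projector onto the
line. -/
lemma lineProj_mulVec_eq (T : Matrix (Fin 2) (Fin 2) ℂ) {v : Fin 2 → ℂ} (hv : v ≠ 0) :
    lineProj (T *ᵥ v) = (T * lineProj v * Tᴴ).trace⁻¹ • (T * lineProj v * Tᴴ) := by
  have h := star_dotProduct_self_ne_zero hv
  have e : T * lineProj v * Tᴴ
      = (star v ⬝ᵥ v)⁻¹ • Matrix.vecMulVec (T *ᵥ v) (star (T *ᵥ v)) := by
    rw [lineProj, Matrix.mul_smul, Matrix.smul_mul, Matrix.mul_vecMulVec, Matrix.vecMulVec_mul,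
      Matrix.star_mulVec]
  rw [e, Matrix.trace_smul, Matrix.trace_vecMulVec, lineProj, smul_smul, dotProduct_comm,
    smul_eq_mul, mul_inv, inv_inv, mul_right_comm, mul_inv_cancel₀ h, one_mul]

/-- The elementary Darboux matrix `(z - m*) 1 + (m* - m) P` at the spectral parameter `z`, where
`P` is the projector onto the line of `v`. -/
def darbouxF (m : ℂ) (v : Fin 2 → ℂ) (z : ℂ) : Matrix (Fin 2) (Fin 2) ℂ :=
  (z - conj m) • (1 : Matrix (Fin 2) (Fin 2) ℂ) + (conj m - m) • lineProj v

lemma conjTranspose_darbouxF (m : ℂ) (v : Fin 2 → ℂ) (z : ℂ) :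
    (darbouxF m v (conj z))ᴴ
      = (z - m) • (1 : Matrix (Fin 2) (Fin 2) ℂ) + (m - conj m) • lineProj v := by
  simp [darbouxF, conjTranspose_lineProj]

lemma conjTranspose_darbouxF_mul (m : ℂ) (v : Fin 2 → ℂ) (z : ℂ) :
    (darbouxF m v (conj z))ᴴ * darbouxF m v z
      = ((z - m) * (z - conj m)) • (1 : Matrix (Fin 2) (Fin 2) ℂ) := by
  rw [conjTranspose_darbouxF, darbouxF]
  simp only [mul_add, add_mul, Matrix.smul_mul, Matrix.mul_smul, one_mul, mul_one,
    lineProj_mul_self]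
  module

lemma darbouxF_mul_conjTranspose (m : ℂ) (v : Fin 2 → ℂ) (z : ℂ) :
    darbouxF m v z * (darbouxF m v (conj z))ᴴ
      = ((z - m) * (z - conj m)) • (1 : Matrix (Fin 2) (Fin 2) ℂ) := by
  rw [conjTranspose_darbouxF, darbouxF]
  simp only [mul_add, add_mul, Matrix.smul_mul, Matrix.mul_smul, one_mul, mul_one,
    lineProj_mul_self]
  module

lemma darbouxF_mulVec_ne_zero {m z : ℂ} (h1 : z ≠ m) (h2 : z ≠ conj m) (v : Fin 2 → ℂ)
    {x : Fin 2 → ℂ} (hx : x ≠ 0) : darbouxF m v z *ᵥ x ≠ 0 := by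
  intro h
  have h' := congrArg (fun y => (darbouxF m v (conj z))ᴴ *ᵥ y) h
  simp only [Matrix.mulVec_mulVec, conjTranspose_darbouxF_mul, Matrix.mulVec_zero,
    Matrix.smul_mulVec, Matrix.one_mulVec, smul_eq_zero, mul_eq_zero, sub_eq_zero] at h'
  tauto

lemma darbouxF_self_mulVec (m : ℂ) (v : Fin 2 → ℂ) : darbouxF m v m *ᵥ v = 0 := by
  rw [darbouxF, Matrix.add_mulVec, Matrix.smul_mulVec, Matrix.smul_mulVec, lineProj_mulVec_self,
    Matrix.one_mulVec]
  module

lemma darbouxF_conj (m : ℂ) (v : Fin 2 → ℂ) :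
    darbouxF m v (conj m) = (conj m - m) • lineProj v := by
  simp [darbouxF]

/-! ### Nondegeneracy of the iterated Darboux matrix -/

lemma dressD_succ (μ : ℕ → ℂ) (φ : ℕ → Fin 2 → ℂ) (n : ℕ) (z : ℂ) :
    dressD μ φ (n + 1) z = darbouxF (μ n) (dressVec μ φ n) z * dressD μ φ n z := rfl

/-- The unitarity relation `D(z*)† D(z) = ∏ (z - μ_k) (z - μ_k*)`. -/
lemma conjTranspose_dressD_mul (μ : ℕ → ℂ) (φ : ℕ → Fin 2 → ℂ) (n : ℕ) (z : ℂ) :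
    (dressD μ φ n (conj z))ᴴ * dressD μ φ n z
      = (∏ k ∈ Finset.range n, ((z - μ k) * (z - conj (μ k)))) •
        (1 : Matrix (Fin 2) (Fin 2) ℂ) := by
  induction n with
  | zero => simp [dressD]
  | succ n ih =>
    rw [dressD_succ, dressD_succ, Matrix.conjTranspose_mul, Matrix.mul_assoc,
      ← Matrix.mul_assoc (darbouxF _ _ (conj z))ᴴ, conjTranspose_darbouxF_mul, Matrix.smul_mul,
      one_mul, Matrix.mul_smul, ih, smul_smul, Finset.prod_range_succ, mul_comm]

/-- The intermediate dressed vectors `D[n](μ_k) φ_k`, `n ≤ k`, do not vanish. If `μ_k = μ_l*` for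
an earlier `l`, the `l`-th factor is singular at `μ_k`, with kernel orthogonal to the dressed
`φ_l`, and by unitarity the component of the dressed `φ_k` along it is a nonzero multiple of
`φ_l† φ_k`. -/
lemma dressD_mulVec_ne_zero (μ : ℕ → ℂ) (φ : ℕ → Fin 2 → ℂ) (m : ℕ)
    (hφ : ∀ k < m, φ k ≠ 0)
    (hinj : ∀ k < m, ∀ l < m, k ≠ l → μ k ≠ μ l)
    (hreal : ∀ k < m, μ k ≠ conj (μ k))
    (hconj : ∀ k < m, ∀ l < m, μ k = conj (μ l) → star (φ l) ⬝ᵥ φ k ≠ 0) :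
    ∀ k < m, ∀ n ≤ k, dressD μ φ n (μ k) *ᵥ φ k ≠ 0 := by
  intro k
  induction k using Nat.strong_induction_on with
  | _ k IH =>
  intro hk n
  induction n with
  | zero => intro _; simpa [dressD] using hφ k hk
  | succ n ihn =>
    intro hn
    have hnk : n < k := hn
    rw [dressD_succ, ← Matrix.mulVec_mulVec]
    by_cases hc : μ k = conj (μ n)
    · have hD : dressD μ φ n (μ n) *ᵥ φ n ≠ 0 := IH n hnk (hnk.trans hk) n le_rfl
      have hD' := star_dotProduct_self_ne_zero hD
      rw [hc, darbouxF_conj, Matrix.smul_mulVec, lineProj_mulVec, smul_smul]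
      refine smul_ne_zero (mul_ne_zero (sub_ne_zero.2 (hreal n (hnk.trans hk)).symm)
        (mul_ne_zero (inv_ne_zero hD') ?_)) hD
      have := conjTranspose_dressD_mul μ φ n (conj (μ n))
      rw [conj_conj] at this
      rw [dressVec, Matrix.star_mulVec, ← Matrix.dotProduct_mulVec, Matrix.mulVec_mulVec, this,
        Matrix.smul_mulVec, Matrix.one_mulVec, dotProduct_smul, smul_eq_mul]
      refine mul_ne_zero (Finset.prod_ne_zero_iff.2 fun l hl => ?_)
        (hconj k hk n (hnk.trans hk) hc)
      have hln := Finset.mem_range.1 hl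
      refine mul_ne_zero (sub_ne_zero.2 ?_) (sub_ne_zero.2 ?_)
      · rw [← hc]
        exact hinj k hk l (by omega) (by omega)
      · exact fun h => hinj n (by omega) l (by omega) (by omega) ((starRingEnd ℂ).injective h)
    · exact darbouxF_mulVec_ne_zero (hinj k hk n (by omega) (by omega)) hc _ (ihn (by omega))

/-! ### Zeros of solutions of the Lax system -/

/-- Uniqueness for linear systems: a solution on the half-line with a zero vanishes. -/
lemma eq_zero_of_linear_ode {A : ℝ → Matrix (Fin 2) (Fin 2) ℂ} {f : ℝ → Fin 2 → ℂ}
    (hA : ∀ i j, ContinuousOn (fun t => A t i j) (Ici 0))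
    (hf : ∀ t, 0 ≤ t → HasDerivWithinAt f (A t *ᵥ f t) (Ici 0) t)
    {t₀ : ℝ} (ht₀ : 0 ≤ t₀) (h0 : f t₀ = 0) {t : ℝ} (ht : 0 ≤ t) : f t = 0 := by
  have hc : ContinuousOn f (Ici 0) := fun s hs => (hf s hs).continuousWithinAt
  have hS : ContinuousOn (fun s => ∑ i, ∑ j, ‖A s i j‖) (Icc 0 (max t t₀)) :=
    (continuousOn_finsetSum _ fun i _ => continuousOn_finsetSum _ fun j _ =>
      (hA i j).norm).mono Icc_subset_Ici_self
  obtain ⟨C, hC⟩ := isCompact_Icc.exists_bound_of_continuousOn hS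
  have hL : ∀ s ∈ Icc 0 (max t t₀), LipschitzOnWith (Real.toNNReal C) (fun x => A s *ᵥ x) univ := by
    intro s hs
    refine LipschitzOnWith.of_dist_le_mul fun x _ y _ => ?_
    have h1 : ∑ i, ∑ j, ‖A s i j‖ ≤ C := (le_abs_self _).trans (hC s hs)
    have hC0 : 0 ≤ C := le_trans (by positivity) h1
    rw [dist_eq_norm, dist_eq_norm, ← Matrix.mulVec_sub, Real.coe_toNNReal _ hC0,
      pi_norm_le_iff_of_nonneg (by positivity)]
    intro i
    calc ‖(A s *ᵥ (x - y)) i‖ ≤ ∑ j, ‖A s i j‖ * ‖x - y‖ := by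
          rw [Matrix.mulVec, dotProduct]
          refine (norm_sum_le _ _).trans (Finset.sum_le_sum fun j _ => ?_)
          rw [norm_mul]
          gcongr
          exact norm_le_pi_norm _ j
      _ = (∑ j, ‖A s i j‖) * ‖x - y‖ := by rw [Finset.sum_mul]
      _ ≤ C * ‖x - y‖ := by
          gcongr
          refine le_trans ?_ h1
          exact Finset.single_le_sum (f := fun i => ∑ j, ‖A s i j‖)
            (fun _ _ => by positivity) (Finset.mem_univ i)
  have hz : ∀ s, HasDerivAt (fun _ : ℝ => (0 : Fin 2 → ℂ)) (A s *ᵥ 0) s := by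
    intro s
    rw [Matrix.mulVec_zero]
    exact hasDerivAt_const _ _
  rcases le_total t₀ t with h | h
  · refine ODE_solution_unique_of_mem_Icc_right (v := fun s x => A s *ᵥ x) (s := fun _ => univ)
      (g := fun _ => 0) (a := t₀) (b := t)
      (fun s hs => hL s ⟨ht₀.trans hs.1, hs.2.le.trans (le_max_left _ _)⟩)
      (hc.mono fun s hs => ht₀.trans hs.1)
      (fun s hs => (hf s (ht₀.trans hs.1)).mono (Ici_subset_Ici.2 (ht₀.trans hs.1)))
      (fun _ _ => mem_univ _) continuousOn_const (fun s _ => (hz s).hasDerivWithinAt)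
      (fun _ _ => mem_univ _) h0 ⟨h, le_rfl⟩
  · refine ODE_solution_unique_of_mem_Icc_left (v := fun s x => A s *ᵥ x) (s := fun _ => univ)
      (g := fun _ => 0) (a := t) (b := t₀)
      (fun s hs => hL s ⟨ht.trans hs.1.le, hs.2.trans (le_max_right _ _)⟩)
      (hc.mono fun s hs => ht.trans hs.1)
      (fun s hs => ((hf s (ht.trans hs.1.le)).hasDerivAt
        (Ici_mem_nhds (ht.trans_lt hs.1))).hasDerivWithinAt)
      (fun _ _ => mem_univ _) continuousOn_const (fun s _ => (hz s).hasDerivWithinAt)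
      (fun _ _ => mem_univ _) h0 ⟨le_rfl, h⟩

lemma continuousOn_x_of_quadrant {E : Type*} [TopologicalSpace E] {f : ℝ → ℝ → E}
    (hf : ContinuousOn (fun p : ℝ × ℝ => f p.1 p.2) quadrant) {t : ℝ} (ht : 0 ≤ t) :
    ContinuousOn (fun x => f t x) (Ici 0) :=
  hf.comp (f := fun x => (t, x)) (by fun_prop) fun _ hx => ⟨ht, hx⟩

lemma continuousOn_t_of_quadrant {E : Type*} [TopologicalSpace E] {f : ℝ → ℝ → E}
    (hf : ContinuousOn (fun p : ℝ × ℝ => f p.1 p.2) quadrant) {x : ℝ} (hx : 0 ≤ x) :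
    ContinuousOn (fun t => f t x) (Ici 0) :=
  hf.comp (f := fun t => (t, x)) (by fun_prop) fun _ ht => ⟨ht, hx⟩

lemma continuousOn_laxU {u : ℝ → ℝ → ℂ} (hu : IsNLSSolution u) (z : ℂ) (i j : Fin 2) :
    ContinuousOn (fun p : ℝ × ℝ => laxU u z p.1 p.2 i j) quadrant := by
  have h1 := hu.cont
  have h2 := continuous_conj.comp_continuousOn h1
  fin_cases i <;> fin_cases j <;> simp [laxU, sigma3, potQ] <;> fun_prop

lemma continuousOn_laxV {u : ℝ → ℝ → ℂ} (hu : IsNLSSolution u) (z : ℂ) (i j : Fin 2) :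
    ContinuousOn (fun p : ℝ × ℝ => laxV u z p.1 p.2 i j) quadrant := by
  have h1 := hu.cont
  have h2 := continuous_conj.comp_continuousOn h1
  have h3 := hu.cont_x
  have h4 := continuous_conj.comp_continuousOn h3
  have h5 := continuous_ofReal.comp_continuousOn h1.norm
  simp only [Function.comp_def] at h2 h4 h5
  fin_cases i <;> fin_cases j <;> simp [laxV, sigma3] <;> fun_prop

lemma IsLaxSolution.eq_zero {u : ℝ → ℝ → ℂ} {z : ℂ} {ψ : ℝ → ℝ → Fin 2 → ℂ}
    (h : IsLaxSolution u z ψ) (hu : IsNLSSolution u) {t₀ x₀ t x : ℝ} (ht₀ : 0 ≤ t₀)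
    (hx₀ : 0 ≤ x₀) (h0 : ψ t₀ x₀ = 0) (ht : 0 ≤ t) (hx : 0 ≤ x) : ψ t x = 0 := by
  have h1 : ψ t₀ x = 0 := eq_zero_of_linear_ode
    (fun i j => continuousOn_x_of_quadrant (f := fun t x => laxU u z t x i j)
      (continuousOn_laxU hu z i j) ht₀)
    (fun y hy => h.x_part t₀ y ht₀ hy) hx₀ h0 hx
  exact eq_zero_of_linear_ode (f := fun t => ψ t x)
    (fun i j => continuousOn_t_of_quadrant (f := fun t x => laxV u z t x i j)
      (continuousOn_laxV hu z i j) hx)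
    (fun s hs => h.t_part s x hs hx) ht₀ h1 ht

/-! ### Evolution of the projectors -/

/-- Evolution of the projector `P` onto the line of a solution of `φ' = W φ`, in entries:
`P' = W P + P W† - tr ((W + W†) P) P`. -/
lemma hasDerivWithinAt_lineProj {φ : ℝ → Fin 2 → ℂ} {W : Matrix (Fin 2) (Fin 2) ℂ} {S : Set ℝ}
    {t : ℝ} (hφ : HasDerivWithinAt φ (W *ᵥ φ t) S t) (h0 : φ t ≠ 0) (i j : Fin 2) :
    HasDerivWithinAt (fun s => lineProj (φ s) i j)
      ((W * lineProj (φ t) + lineProj (φ t) * Wᴴ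
        - ((W + Wᴴ) * lineProj (φ t)).trace • lineProj (φ t)) i j) S t := by
  have hn := star_dotProduct_self_ne_zero h0
  have hφi : ∀ i, HasDerivWithinAt (fun s => φ s i) ((W *ᵥ φ t) i) S t :=
    hasDerivWithinAt_pi.1 hφ
  have hφs : ∀ i, HasDerivWithinAt (fun s => conj (φ s i)) (conj ((W *ᵥ φ t) i)) S t :=
    fun i => (hφi i).star
  have hN : HasDerivWithinAt (fun s => star (φ s) ⬝ᵥ φ s)
      (conj ((W *ᵥ φ t) 0) * φ t 0 + conj (φ t 0) * (W *ᵥ φ t) 0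
        + (conj ((W *ᵥ φ t) 1) * φ t 1 + conj (φ t 1) * (W *ᵥ φ t) 1)) S t := by
    simp only [dotProduct, Fin.sum_univ_two, Pi.star_apply, star_def]
    exact ((hφs 0).mul (hφi 0)).add ((hφs 1).mul (hφi 1))
  have h := (hN.fun_inv hn).mul ((hφi i).mul (hφs j))
  simp only [lineProj_apply]
  refine h.congr_deriv ?_
  simp only [Matrix.sub_apply, Matrix.add_apply, Matrix.smul_apply, Matrix.trace_fin_two,
    Matrix.mul_apply, Matrix.conjTranspose_apply, Fin.sum_univ_two, lineProj_apply, Matrix.mulVec,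
    dotProduct, map_add, map_mul, Pi.star_apply, star_def, smul_eq_mul] at hn ⊢
  fin_cases i <;> fin_cases j <;> simp <;> field_simp <;> ring

/-! ### The elementary Darboux transformation -/

/-- The elementary Darboux transform `u - 2i (m - m*) P₁₂` of `u`, where `P` is the projector onto
the line of a Lax solution `φ` at the spectral parameter `m`. -/
def darbouxU (u : ℝ → ℝ → ℂ) (m : ℂ) (φ : ℝ → ℝ → Fin 2 → ℂ) (t x : ℝ) : ℂ :=
  u t x - 2 * I * (m - conj m) * lineProj (φ t x) 0 1

/-- The `x` derivative of the off-diagonal entry `b` of the projector, in terms of its diagonal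
entry `p`. -/
def offDiagDx (u : ℝ → ℝ → ℂ) (m : ℂ) (φ : ℝ → ℝ → Fin 2 → ℂ) (t x : ℝ) : ℂ :=
  -(I * (m + conj m)) * lineProj (φ t x) 0 1
    + (u t x - I * (m - conj m) * lineProj (φ t x) 0 1) * (1 - 2 * lineProj (φ t x) 0 0)

/-- The `x` derivative of the diagonal entry `p` of the projector. -/
def diagDx (u : ℝ → ℝ → ℂ) (m : ℂ) (φ : ℝ → ℝ → Fin 2 → ℂ) (t x : ℝ) : ℂ :=
  u t x * conj (lineProj (φ t x) 0 1) + conj (u t x) * lineProj (φ t x) 0 1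
    - 2 * I * (m - conj m) * (lineProj (φ t x) 0 0 - lineProj (φ t x) 0 0 ^ 2)

/-- The `t` derivative of the diagonal entry `p` of the projector. -/
def diagDt (u : ℝ → ℝ → ℂ) (m : ℂ) (φ : ℝ → ℝ → Fin 2 → ℂ) (t x : ℝ) : ℂ :=
  -(4 * I * (m ^ 2 - conj m ^ 2)) * (lineProj (φ t x) 0 0 - lineProj (φ t x) 0 0 ^ 2)
    + (2 * m * u t x + I * dx u t x) * conj (lineProj (φ t x) 0 1)
    + (2 * conj m * conj (u t x) - I * conj (dx u t x)) * lineProj (φ t x) 0 1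
    - 2 * (m - conj m) * (u t x * conj (lineProj (φ t x) 0 1)
        - conj (u t x) * lineProj (φ t x) 0 1) * lineProj (φ t x) 0 0

/-- The `t` derivative of the off-diagonal entry `b` of the projector. -/
def offDiagDt (u : ℝ → ℝ → ℂ) (m : ℂ) (φ : ℝ → ℝ → Fin 2 → ℂ) (t x : ℝ) : ℂ :=
  (-(2 * I * (m ^ 2 + conj m ^ 2)) + 2 * I * (u t x * conj (u t x))) * lineProj (φ t x) 0 1
    + (2 * m * u t x + I * dx u t x) * (1 - lineProj (φ t x) 0 0)
    - (2 * conj m * u t x + I * dx u t x) * lineProj (φ t x) 0 0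
    - (2 * I * (m ^ 2 - conj m ^ 2) * (1 - 2 * lineProj (φ t x) 0 0)
        + 2 * (m - conj m) * (u t x * conj (lineProj (φ t x) 0 1)
          - conj (u t x) * lineProj (φ t x) 0 1)) * lineProj (φ t x) 0 1

lemma norm_sq_eq_mul_conj (z : ℂ) : (‖z‖ : ℂ) ^ 2 = z * conj z := (Complex.mul_conj' z).symm

lemma laxU_eq (u : ℝ → ℝ → ℂ) (z : ℂ) (t x : ℝ) :
    laxU u z t x = !![-(I * z), u t x; -conj (u t x), I * z] := by
  ext i j
  fin_cases i <;> fin_cases j <;> simp [laxU, sigma3, potQ]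

lemma laxV_eq (u : ℝ → ℝ → ℂ) (z : ℂ) (t x : ℝ) :
    laxV u z t x = !![-(2 * I * z ^ 2) + I * (u t x * conj (u t x)), 2 * z * u t x + I * dx u t x;
      -(2 * z * conj (u t x)) + I * conj (dx u t x),
      2 * I * z ^ 2 - I * (u t x * conj (u t x))] := by
  ext i j
  fin_cases i <;> fin_cases j <;> simp [laxV, sigma3, norm_sq_eq_mul_conj, sub_eq_add_neg]

section Derivatives

variable {u : ℝ → ℝ → ℂ} {m : ℂ} {φ : ℝ → ℝ → Fin 2 → ℂ}

lemma hasDerivWithinAt_diag_x (hφ : IsLaxSolution u m φ) {t x : ℝ} (ht : 0 ≤ t) (hx : 0 ≤ x)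
    (h0 : φ t x ≠ 0) :
    HasDerivWithinAt (fun y => lineProj (φ t y) 0 0) (diagDx u m φ t x) (Ici 0) x := by
  refine (hasDerivWithinAt_lineProj (hφ.x_part t x ht hx) h0 0 0).congr_deriv ?_
  have h1 := lineProj_one_one h0
  simp only [laxU_eq, Matrix.sub_apply, Matrix.add_apply, Matrix.smul_apply,
    Matrix.trace_fin_two, Matrix.mul_apply, Matrix.conjTranspose_apply, Fin.sum_univ_two,
    lineProj_one_zero, h1, Matrix.of_apply, Matrix.cons_val_zero, Matrix.cons_val_one,
    star_def, map_add, map_sub, map_neg, map_mul, map_pow, conj_I, conj_conj, map_ofNat,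
    smul_eq_mul, diagDx]
  ring

lemma hasDerivWithinAt_offDiag_x (hφ : IsLaxSolution u m φ) {t x : ℝ} (ht : 0 ≤ t) (hx : 0 ≤ x)
    (h0 : φ t x ≠ 0) :
    HasDerivWithinAt (fun y => lineProj (φ t y) 0 1) (offDiagDx u m φ t x) (Ici 0) x := by
  refine (hasDerivWithinAt_lineProj (hφ.x_part t x ht hx) h0 0 1).congr_deriv ?_
  have h1 := lineProj_one_one h0
  simp only [laxU_eq, Matrix.sub_apply, Matrix.add_apply, Matrix.smul_apply,
    Matrix.trace_fin_two, Matrix.mul_apply, Matrix.conjTranspose_apply, Fin.sum_univ_two,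
    lineProj_one_zero, h1, Matrix.of_apply, Matrix.cons_val_zero, Matrix.cons_val_one,
    star_def, map_add, map_sub, map_neg, map_mul, map_pow, conj_I, conj_conj, map_ofNat,
    smul_eq_mul, offDiagDx]
  ring

lemma hasDerivWithinAt_diag_t (hφ : IsLaxSolution u m φ) {t x : ℝ} (ht : 0 ≤ t) (hx : 0 ≤ x)
    (h0 : φ t x ≠ 0) :
    HasDerivWithinAt (fun s => lineProj (φ s x) 0 0) (diagDt u m φ t x) (Ici 0) t := by
  refine (hasDerivWithinAt_lineProj (hφ.t_part t x ht hx) h0 0 0).congr_deriv ?_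
  have h1 := lineProj_one_one h0
  simp only [laxV_eq, Matrix.sub_apply, Matrix.add_apply, Matrix.smul_apply,
    Matrix.trace_fin_two, Matrix.mul_apply, Matrix.conjTranspose_apply, Fin.sum_univ_two,
    lineProj_one_zero, h1, Matrix.of_apply, Matrix.cons_val_zero, Matrix.cons_val_one,
    star_def, map_add, map_sub, map_neg, map_mul, map_pow, conj_I, conj_conj, map_ofNat,
    smul_eq_mul, diagDt]
  ring

lemma hasDerivWithinAt_offDiag_t (hφ : IsLaxSolution u m φ) {t x : ℝ} (ht : 0 ≤ t) (hx : 0 ≤ x)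
    (h0 : φ t x ≠ 0) :
    HasDerivWithinAt (fun s => lineProj (φ s x) 0 1) (offDiagDt u m φ t x) (Ici 0) t := by
  refine (hasDerivWithinAt_lineProj (hφ.t_part t x ht hx) h0 0 1).congr_deriv ?_
  have h1 := lineProj_one_one h0
  simp only [laxV_eq, Matrix.sub_apply, Matrix.add_apply, Matrix.smul_apply,
    Matrix.trace_fin_two, Matrix.mul_apply, Matrix.conjTranspose_apply, Fin.sum_univ_two,
    lineProj_one_zero, h1, Matrix.of_apply, Matrix.cons_val_zero, Matrix.cons_val_one,
    star_def, map_add, map_sub, map_neg, map_mul, map_pow, conj_I, conj_conj, map_ofNat,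
    smul_eq_mul, offDiagDt]
  ring

end Derivatives

lemma conj_darbouxU (u : ℝ → ℝ → ℂ) (m : ℂ) (φ : ℝ → ℝ → Fin 2 → ℂ) (t x : ℝ) :
    conj (darbouxU u m φ t x)
      = conj (u t x) - 2 * I * (m - conj m) * conj (lineProj (φ t x) 0 1) := by
  simp only [darbouxU, map_sub, map_mul, conj_I, conj_conj, map_ofNat]
  ring

/-- The Darboux relation `F_x = U' F - F U`. -/
lemma darboux_x_identity (u : ℝ → ℝ → ℂ) (m z : ℂ) (φ : ℝ → ℝ → Fin 2 → ℂ) {t x : ℝ}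
    (h0 : φ t x ≠ 0) :
    (conj m - m) • (laxU u m t x * lineProj (φ t x) + lineProj (φ t x) * (laxU u m t x)ᴴ
        - ((laxU u m t x + (laxU u m t x)ᴴ) * lineProj (φ t x)).trace • lineProj (φ t x))
      = laxU (darbouxU u m φ) z t x * darbouxF m (φ t x) z
        - darbouxF m (φ t x) z * laxU u z t x := by
  have h1 := lineProj_one_one h0
  have h2 := lineProj_normSq_offDiag (φ t x)
  ext i j
  fin_cases i <;> fin_cases j <;>
  simp only [laxU_eq, Matrix.sub_apply, Matrix.add_apply, Matrix.smul_apply, darbouxF,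
    Matrix.trace_fin_two, Matrix.mul_apply, Matrix.conjTranspose_apply, Fin.sum_univ_two,
    lineProj_one_zero, h1, Matrix.of_apply, Matrix.cons_val_zero, Matrix.cons_val_one,
    star_def, map_add, map_sub, map_neg, map_mul, map_pow, conj_I, conj_conj, map_ofNat,
    smul_eq_mul, Fin.zero_eta, Fin.mk_one, conj_darbouxU, Matrix.one_apply_eq,
    Matrix.one_apply_ne, ne_eq, zero_ne_one, one_ne_zero, not_false_eq_true]
    <;> try simp only [darbouxU]
  all_goals
    clear h0 h1
    generalize lineProj (φ t x) 0 0 = p at *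
    generalize conj (lineProj (φ t x) 0 1) = bs at *
    generalize lineProj (φ t x) 0 1 = b at *
    generalize conj (u t x) = us
    generalize u t x = u
    generalize conj m = ms
    clear φ t x
    grind

lemma hasDerivWithinAt_darbouxU_x {u : ℝ → ℝ → ℂ} {m : ℂ} {φ : ℝ → ℝ → Fin 2 → ℂ}
    (hu : IsNLSSolution u) (hφ : IsLaxSolution u m φ) {t x : ℝ} (ht : 0 ≤ t) (hx : 0 ≤ x)
    (h0 : φ t x ≠ 0) :
    HasDerivWithinAt (fun y => darbouxU u m φ t y)
      (dx u t x - 2 * I * (m - conj m) * offDiagDx u m φ t x) (Ici 0) x :=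
  (hu.diff_x t x ht hx).hasDerivWithinAt.sub
    ((hasDerivWithinAt_offDiag_x hφ ht hx h0).const_mul _)

/-- The Darboux relation `F_t = V' F - F V`. -/
lemma darboux_t_identity (u : ℝ → ℝ → ℂ) (m z : ℂ) (φ : ℝ → ℝ → Fin 2 → ℂ) {t x : ℝ}
    (h0 : φ t x ≠ 0)
    (hd : dx (darbouxU u m φ) t x = dx u t x - 2 * I * (m - conj m) * offDiagDx u m φ t x) :
    (conj m - m) • (laxV u m t x * lineProj (φ t x) + lineProj (φ t x) * (laxV u m t x)ᴴ
        - ((laxV u m t x + (laxV u m t x)ᴴ) * lineProj (φ t x)).trace • lineProj (φ t x))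
      = laxV (darbouxU u m φ) z t x * darbouxF m (φ t x) z
        - darbouxF m (φ t x) z * laxV u z t x := by
  have h1 := lineProj_one_one h0
  have h2 := lineProj_normSq_offDiag (φ t x)
  have hI := I_mul_I
  ext i j
  fin_cases i <;> fin_cases j <;>
  simp only [laxV_eq, Matrix.sub_apply, Matrix.add_apply, Matrix.smul_apply, darbouxF,
    Matrix.trace_fin_two, Matrix.mul_apply, Matrix.conjTranspose_apply, Fin.sum_univ_two,
    lineProj_one_zero, h1, Matrix.of_apply, Matrix.cons_val_zero, Matrix.cons_val_one,
    star_def, map_add, map_sub, map_neg, map_mul, map_pow, conj_I, conj_conj, map_ofNat,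
    smul_eq_mul, Fin.zero_eta, Fin.mk_one, conj_darbouxU, Matrix.one_apply_eq, hd, offDiagDx,
    Matrix.one_apply_ne, ne_eq, zero_ne_one, one_ne_zero, not_false_eq_true, map_one,
    conj_lineProj_diag]
    <;> try simp only [darbouxU]
  all_goals
    clear h0 h1 hd
    generalize lineProj (φ t x) 0 0 = p at *
    generalize conj (lineProj (φ t x) 0 1) = bs at *
    generalize lineProj (φ t x) 0 1 = b at *
    generalize conj (u t x) = us
    generalize conj (dx u t x) = vs
    generalize dx u t x = v
    generalize u t x = u
    generalize conj m = ms
    generalize I = i at *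
    clear φ t x
    grind

lemma dx_eq_of_hasDerivWithinAt {f : ℝ → ℝ → ℂ} {t x : ℝ} {f' : ℂ} (hx : 0 ≤ x)
    (h : HasDerivWithinAt (fun y => f t y) f' (Ici 0) x) : dx f t x = f' :=
  h.derivWithin (uniqueDiffOn_Ici 0 x hx)

lemma dt_eq_of_hasDerivWithinAt {f : ℝ → ℝ → ℂ} {t x : ℝ} {f' : ℂ} (ht : 0 ≤ t)
    (h : HasDerivWithinAt (fun s => f s x) f' (Ici 0) t) : dt f t x = f' :=
  h.derivWithin (uniqueDiffOn_Ici 0 t ht)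

lemma continuousOn_lineProj {u : ℝ → ℝ → ℂ} {m : ℂ} {φ : ℝ → ℝ → Fin 2 → ℂ}
    (hφ : IsLaxSolution u m φ) (h0 : ∀ t x : ℝ, 0 ≤ t → 0 ≤ x → φ t x ≠ 0) (i j : Fin 2) :
    ContinuousOn (fun q : ℝ × ℝ => lineProj (φ q.1 q.2) i j) quadrant := by
  have h : ∀ i, ContinuousOn (fun q : ℝ × ℝ => φ q.1 q.2 i) quadrant :=
    continuousOn_pi.1 hφ.cont
  have hs : ∀ i, ContinuousOn (fun q : ℝ × ℝ => conj (φ q.1 q.2 i)) quadrant :=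
    fun i => continuous_conj.comp_continuousOn (h i)
  simp only [lineProj_apply]
  refine ContinuousOn.mul (ContinuousOn.inv₀ ?_ fun q hq =>
    star_dotProduct_self_ne_zero (h0 q.1 q.2 hq.1 hq.2)) ((h i).mul (hs j))
  simp only [dotProduct, Fin.sum_univ_two, Pi.star_apply, star_def]
  exact ((hs 0).mul (h 0)).add ((hs 1).mul (h 1))

section Step

variable {u : ℝ → ℝ → ℂ} {m : ℂ} {φ : ℝ → ℝ → Fin 2 → ℂ}

/-- The second `x` derivative of the off-diagonal entry of the projector. -/
def offDiagDxx (u : ℝ → ℝ → ℂ) (m : ℂ) (φ : ℝ → ℝ → Fin 2 → ℂ) (t x : ℝ) : ℂ :=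
  -(I * (m + conj m)) * offDiagDx u m φ t x
    + ((dx u t x - I * (m - conj m) * offDiagDx u m φ t x) * (1 - 2 * lineProj (φ t x) 0 0)
      + (u t x - I * (m - conj m) * lineProj (φ t x) 0 1) * -(2 * diagDx u m φ t x))

lemma hasDerivWithinAt_offDiagDx_x (hu : IsNLSSolution u) (hφ : IsLaxSolution u m φ) {t x : ℝ}
    (ht : 0 ≤ t) (hx : 0 ≤ x) (h0 : φ t x ≠ 0) :
    HasDerivWithinAt (fun y => offDiagDx u m φ t y) (offDiagDxx u m φ t x) (Ici 0) x := by
  have h1 := (hu.diff_x t x ht hx).hasDerivWithinAt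
  have h2 := hasDerivWithinAt_offDiag_x hφ ht hx h0
  have h3 := hasDerivWithinAt_diag_x hφ ht hx h0
  exact (h2.const_mul _).add ((h1.sub (h2.const_mul _)).mul ((h3.const_mul 2).const_sub 1))

/-- The Darboux transform of a classical solution of the focusing NLS equation is again a classical
solution: the derivatives of the projector are polynomials in `u`, `u_x` and its entries. -/
theorem isNLSSolution_darbouxU (hu : IsNLSSolution u) (hφ : IsLaxSolution u m φ)
    (h0 : ∀ t x : ℝ, 0 ≤ t → 0 ≤ x → φ t x ≠ 0) : IsNLSSolution (darbouxU u m φ) := by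
  have hX : ∀ t x : ℝ, 0 ≤ t → 0 ≤ x → HasDerivWithinAt (fun y => darbouxU u m φ t y)
      (dx u t x - 2 * I * (m - conj m) * offDiagDx u m φ t x) (Ici 0) x :=
    fun t x ht hx => hasDerivWithinAt_darbouxU_x hu hφ ht hx (h0 t x ht hx)
  have eX : ∀ t x : ℝ, 0 ≤ t → 0 ≤ x → dx (darbouxU u m φ) t x
      = dx u t x - 2 * I * (m - conj m) * offDiagDx u m φ t x :=
    fun t x ht hx => dx_eq_of_hasDerivWithinAt hx (hX t x ht hx)
  have hXX : ∀ t x : ℝ, 0 ≤ t → 0 ≤ x →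
      HasDerivWithinAt (fun y => dx (darbouxU u m φ) t y)
      (dx (dx u) t x - 2 * I * (m - conj m) * offDiagDxx u m φ t x) (Ici 0) x := by
    intro t x ht hx
    refine HasDerivWithinAt.congr ((hu.diff_xx t x ht hx).hasDerivWithinAt.sub
      ((hasDerivWithinAt_offDiagDx_x hu hφ ht hx (h0 t x ht hx)).const_mul _))
      (fun y hy => eX t y ht hy) (eX t x ht hx)
  have eXX : ∀ t x : ℝ, 0 ≤ t → 0 ≤ x → dx (dx (darbouxU u m φ)) t x
      = dx (dx u) t x - 2 * I * (m - conj m) * offDiagDxx u m φ t x :=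
    fun t x ht hx => dx_eq_of_hasDerivWithinAt hx (hXX t x ht hx)
  have hT : ∀ t x : ℝ, 0 ≤ t → 0 ≤ x → HasDerivWithinAt (fun s => darbouxU u m φ s x)
      (dt u t x - 2 * I * (m - conj m) * offDiagDt u m φ t x) (Ici 0) t :=
    fun t x ht hx => (hu.diff_t t x ht hx).hasDerivWithinAt.sub
      ((hasDerivWithinAt_offDiag_t hφ ht hx (h0 t x ht hx)).const_mul _)
  have eT : ∀ t x : ℝ, 0 ≤ t → 0 ≤ x → dt (darbouxU u m φ) t x
      = dt u t x - 2 * I * (m - conj m) * offDiagDt u m φ t x :=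
    fun t x ht hx => dt_eq_of_hasDerivWithinAt ht (hT t x ht hx)
  have c1 := hu.cont
  have c2 := continuous_conj.comp_continuousOn c1
  have c3 := hu.cont_x
  have c4 := continuous_conj.comp_continuousOn c3
  have c5 := hu.cont_xx
  have c6 := hu.cont_t
  have c7 := continuousOn_lineProj hφ h0 0 0
  have c8 := continuousOn_lineProj hφ h0 0 1
  have c9 := continuous_conj.comp_continuousOn c8
  simp only [Function.comp_def] at c2 c4 c9
  refine ⟨fun t x ht hx => (hT t x ht hx).differentiableWithinAt,
    fun t x ht hx => (hX t x ht hx).differentiableWithinAt,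
    fun t x ht hx => (hXX t x ht hx).differentiableWithinAt, ?_, ?_, ?_, ?_, ?_⟩
  · unfold darbouxU
    fun_prop
  · refine ContinuousOn.congr (f := fun q : ℝ × ℝ =>
      dt u q.1 q.2 - 2 * I * (m - conj m) * offDiagDt u m φ q.1 q.2) ?_
      fun q hq => eT q.1 q.2 hq.1 hq.2
    unfold offDiagDt
    fun_prop
  · refine ContinuousOn.congr (f := fun q : ℝ × ℝ =>
      dx u q.1 q.2 - 2 * I * (m - conj m) * offDiagDx u m φ q.1 q.2) ?_
      fun q hq => eX q.1 q.2 hq.1 hq.2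
    unfold offDiagDx
    fun_prop
  · refine ContinuousOn.congr (f := fun q : ℝ × ℝ =>
      dx (dx u) q.1 q.2 - 2 * I * (m - conj m) * offDiagDxx u m φ q.1 q.2) ?_
      fun q hq => eXX q.1 q.2 hq.1 hq.2
    unfold offDiagDxx offDiagDx diagDx
    fun_prop
  · intro t x ht hx
    have h1 := lineProj_one_one (h0 t x ht hx)
    have h2 := lineProj_normSq_offDiag (φ t x)
    have hI := I_mul_I
    have he := hu.eqn t x ht hx
    rw [norm_sq_eq_mul_conj] at he ⊢
    rw [eT t x ht hx, eXX t x ht hx, conj_darbouxU]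
    simp only [darbouxU, offDiagDxx, offDiagDt, offDiagDx, diagDx]
    clear h1 eT hT eXX hXX eX hX c1 c2 c3 c4 c5 c6 c7 c8 c9 h0 hφ hu
    generalize lineProj (φ t x) 0 0 = p at *
    generalize conj (lineProj (φ t x) 0 1) = bs at *
    generalize lineProj (φ t x) 0 1 = b at *
    generalize conj (dx u t x) = vs at *
    generalize dx (dx u) t x = w at *
    generalize dx u t x = v at *
    generalize dt u t x = r at *
    generalize conj (u t x) = us at *
    generalize u t x = u at *
    generalize conj m = ms at *
    generalize I = i at *
    clear hx ht
    grind

lemma hasDerivWithinAt_darbouxF_x (hφ : IsLaxSolution u m φ) {t x : ℝ} (ht : 0 ≤ t) (hx : 0 ≤ x)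
    (h0 : φ t x ≠ 0) (z : ℂ) (i j : Fin 2) :
    HasDerivWithinAt (fun y => darbouxF m (φ t y) z i j)
      ((laxU (darbouxU u m φ) z t x * darbouxF m (φ t x) z
        - darbouxF m (φ t x) z * laxU u z t x) i j) (Ici 0) x := by
  rw [← darboux_x_identity u m z φ h0]
  exact ((hasDerivWithinAt_lineProj (hφ.x_part t x ht hx) h0 i j).const_mul _).const_add _

lemma hasDerivWithinAt_darbouxF_t (hu : IsNLSSolution u) (hφ : IsLaxSolution u m φ) {t x : ℝ}
    (ht : 0 ≤ t) (hx : 0 ≤ x) (h0 : φ t x ≠ 0) (z : ℂ) (i j : Fin 2) :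
    HasDerivWithinAt (fun s => darbouxF m (φ s x) z i j)
      ((laxV (darbouxU u m φ) z t x * darbouxF m (φ t x) z
        - darbouxF m (φ t x) z * laxV u z t x) i j) (Ici 0) t := by
  rw [← darboux_t_identity u m z φ h0
    (dx_eq_of_hasDerivWithinAt hx (hasDerivWithinAt_darbouxU_x hu hφ ht hx h0))]
  exact ((hasDerivWithinAt_lineProj (hφ.t_part t x ht hx) h0 i j).const_mul _).const_add _

/-- If `A' = W' A - A W` and `χ' = W χ`, then `A χ` solves the system of `W'`. -/
lemma hasDerivWithinAt_gauge {A : ℝ → Matrix (Fin 2) (Fin 2) ℂ} {χ : ℝ → Fin 2 → ℂ}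
    {W W' : Matrix (Fin 2) (Fin 2) ℂ} {S : Set ℝ} {t : ℝ}
    (hA : ∀ i j, HasDerivWithinAt (fun s => A s i j) ((W' * A t - A t * W) i j) S t)
    (hχ : HasDerivWithinAt χ (W *ᵥ χ t) S t) :
    HasDerivWithinAt (fun s => A s *ᵥ χ s) (W' *ᵥ (A t *ᵥ χ t)) S t := by
  have hχi : ∀ i, HasDerivWithinAt (fun s => χ s i) ((W *ᵥ χ t) i) S t :=
    hasDerivWithinAt_pi.1 hχ
  have e : W' *ᵥ (A t *ᵥ χ t) = (W' * A t - A t * W) *ᵥ χ t + A t *ᵥ (W *ᵥ χ t) := by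
    rw [Matrix.sub_mulVec, Matrix.mulVec_mulVec, Matrix.mulVec_mulVec, sub_add_cancel]
  rw [e, hasDerivWithinAt_pi]
  intro i
  have h := ((hA i 0).mul (hχi 0)).add ((hA i 1).mul (hχi 1))
  have e1 : (fun s => (A s *ᵥ χ s) i) = fun s => A s i 0 * χ s 0 + A s i 1 * χ s 1 := by
    funext s
    simp [Matrix.mulVec, dotProduct, Fin.sum_univ_two]
  rw [e1]
  refine h.congr_deriv ?_
  rw [Pi.add_apply]
  simp only [Matrix.mulVec, dotProduct, Fin.sum_univ_two]
  ring

/-- The Darboux matrix maps Lax solutions of `u` to Lax solutions of the transform of `u`. -/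
theorem IsLaxSolution.darbouxF_mulVec (hu : IsNLSSolution u) (hφ : IsLaxSolution u m φ)
    (h0 : ∀ t x : ℝ, 0 ≤ t → 0 ≤ x → φ t x ≠ 0) {z : ℂ} {χ : ℝ → ℝ → Fin 2 → ℂ}
    (hχ : IsLaxSolution u z χ) :
    IsLaxSolution (darbouxU u m φ) z (fun t x => darbouxF m (φ t x) z *ᵥ χ t x) where
  cont := by
    have h : ∀ i, ContinuousOn (fun q : ℝ × ℝ => χ q.1 q.2 i) quadrant :=
      continuousOn_pi.1 hχ.cont
    have hP := fun i j => continuousOn_lineProj hφ h0 i j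
    refine continuousOn_pi.2 fun i => ?_
    simp only [Matrix.mulVec, dotProduct, Fin.sum_univ_two, darbouxF, Matrix.add_apply,
      Matrix.smul_apply, smul_eq_mul]
    exact ((continuousOn_const.add (continuousOn_const.mul (hP i 0))).mul (h 0)).add
      ((continuousOn_const.add (continuousOn_const.mul (hP i 1))).mul (h 1))
  x_part t x ht hx := hasDerivWithinAt_gauge (A := fun y => darbouxF m (φ t y) z)
    (hasDerivWithinAt_darbouxF_x hφ ht hx (h0 t x ht hx) z) (hχ.x_part t x ht hx)
  t_part t x ht hx := hasDerivWithinAt_gauge (A := fun s => darbouxF m (φ s x) z)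
    (χ := fun s => χ s x)
    (hasDerivWithinAt_darbouxF_t hu hφ ht hx (h0 t x ht hx) z) (hχ.t_part t x ht hx)

end Step

/-! ### The boundary matrix and its intertwining with a pair of Darboux matrices -/

/-- The coefficient matrix of the spectral parameter in the boundary matrix. -/
def bdryM (q : ℂ) (om : ℝ) : Matrix (Fin 2) (Fin 2) ℂ := !![(om : ℂ), q; conj q, -(om : ℂ)]

/-- The numerator `(4 z² - c) 1 + 4 i z M` of the boundary matrix. -/
def bdryL (c : ℝ) (M : Matrix (Fin 2) (Fin 2) ℂ) (z : ℂ) : Matrix (Fin 2) (Fin 2) ℂ :=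
  (4 * z ^ 2 - c) • (1 : Matrix (Fin 2) (Fin 2) ℂ) + (4 * I * z) • M

lemma bdryK_eq (α β : ℝ) (q : ℂ) (om : ℝ) (z : ℂ) :
    bdryK α β q om z = ((2 * z - I * (|β| : ℝ)) ^ 2 - (α : ℂ) ^ 2)⁻¹ •
      bdryL (α ^ 2 + β ^ 2) (bdryM q om) z := by
  rw [bdryK]
  congr 1
  ext i j
  fin_cases i <;> fin_cases j <;> simp [bdryL, bdryM] <;> ring

lemma conjTranspose_bdryM (q : ℂ) (om : ℝ) : (bdryM q om)ᴴ = bdryM q om := by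
  ext i j
  fin_cases i <;> fin_cases j <;> simp [bdryM]

lemma bdryM_mul_self (q : ℂ) (om : ℝ) :
    bdryM q om * bdryM q om = ((om ^ 2 + ‖q‖ ^ 2 : ℝ) : ℂ) • (1 : Matrix (Fin 2) (Fin 2) ℂ) := by
  have h := norm_sq_eq_mul_conj q
  ext i j
  fin_cases i <;> fin_cases j <;> simp [bdryM, Matrix.mul_apply, Fin.sum_univ_two, h] <;> ring

lemma bdryL_neg_mul (c b : ℝ) {M : Matrix (Fin 2) (Fin 2) ℂ}
    (hM : M * M = (b : ℂ) • (1 : Matrix (Fin 2) (Fin 2) ℂ)) (z : ℂ) :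
    bdryL c M (-z) * bdryL c M z
      = ((4 * z ^ 2 - c) ^ 2 + 16 * z ^ 2 * b) • (1 : Matrix (Fin 2) (Fin 2) ℂ) := by
  have hI := I_mul_I
  simp only [bdryL, mul_add, add_mul, Matrix.smul_mul, Matrix.mul_smul, one_mul, mul_one, hM,
    smul_smul]
  match_scalars
  · linear_combination (-16 * z ^ 2 * b) * hI
  · ring

lemma conjTranspose_bdryL (c : ℝ) {M : Matrix (Fin 2) (Fin 2) ℂ} (hM : Mᴴ = M) (z : ℂ) :
    (bdryL c M z)ᴴ = bdryL c M (-conj z) := by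
  simp [bdryL, hM]

lemma eq_zero_of_mulVec_orthogonal {C : Matrix (Fin 2) (Fin 2) ℂ} {v y : Fin 2 → ℂ} (hv : v ≠ 0)
    (hy : y ≠ 0) (hvy : star v ⬝ᵥ y = 0) (h1 : C *ᵥ v = 0) (h2 : C *ᵥ y = 0) : C = 0 := by
  have hn := star_dotProduct_self_ne_zero hv
  simp only [dotProduct, Fin.sum_univ_two, Pi.star_apply, star_def] at hvy hn
  have hd : v 0 * y 1 - v 1 * y 0 ≠ 0 := by
    intro h
    apply hy
    have a0 : (conj (v 0) * v 0 + conj (v 1) * v 1) * y 0 = 0 := by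
      linear_combination (v 0) * hvy - conj (v 1) * h
    have a1 : (conj (v 0) * v 0 + conj (v 1) * v 1) * y 1 = 0 := by
      linear_combination (v 1) * hvy + conj (v 0) * h
    ext i
    fin_cases i
    · exact (mul_eq_zero.1 a0).resolve_left hn
    · exact (mul_eq_zero.1 a1).resolve_left hn
  ext i j
  have k1 := congrFun h1 i
  have k2 := congrFun h2 i
  simp only [Matrix.mulVec, dotProduct, Fin.sum_univ_two, Pi.zero_apply] at k1 k2
  have c0 : C i 0 * (v 0 * y 1 - v 1 * y 0) = 0 := by linear_combination y 1 * k1 - v 1 * k2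
  have c1 : C i 1 * (v 0 * y 1 - v 1 * y 0) = 0 := by linear_combination v 0 * k2 - y 0 * k1
  fin_cases j
  · exact (mul_eq_zero.1 c0).resolve_right hd
  · exact (mul_eq_zero.1 c1).resolve_right hd

/-- A nonzero vector orthogonal to `v`. -/
def orthVec (v : Fin 2 → ℂ) : Fin 2 → ℂ := ![-conj (v 1), conj (v 0)]

lemma star_dotProduct_orthVec (v : Fin 2 → ℂ) : star v ⬝ᵥ orthVec v = 0 := by
  simp [orthVec, dotProduct, Fin.sum_univ_two]
  ring

lemma orthVec_ne_zero {v : Fin 2 → ℂ} (hv : v ≠ 0) : orthVec v ≠ 0 := by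
  intro h
  apply hv
  have h0 := congrFun h 0
  have h1 := congrFun h 1
  ext i
  fin_cases i
  · simpa [orthVec] using h1
  · simpa [orthVec] using h0

lemma mulVec_ne_zero_of_mul_eq_smul {A B : Matrix (Fin 2) (Fin 2) ℂ} {s : ℂ} (hs : s ≠ 0)
    (h : A * B = s • (1 : Matrix (Fin 2) (Fin 2) ℂ)) {v : Fin 2 → ℂ} (hv : v ≠ 0) :
    B *ᵥ v ≠ 0 := by
  intro h0
  have h1 : (A * B) *ᵥ v = 0 := by rw [← Matrix.mulVec_mulVec, h0, Matrix.mulVec_zero]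
  rw [h, Matrix.smul_mulVec, Matrix.one_mulVec] at h1
  exact hv ((smul_eq_zero.1 h1).resolve_left hs)

section Pair

variable {c b : ℝ} {M : Matrix (Fin 2) (Fin 2) ℂ} {l : ℂ} {v : Fin 2 → ℂ}

lemma bdryL_mulVec_ne_zero (hM : M * M = (b : ℂ) • (1 : Matrix (Fin 2) (Fin 2) ℂ))
    (hdet : (4 * l ^ 2 - c) ^ 2 + 16 * l ^ 2 * b ≠ 0) (hv : v ≠ 0) : bdryL c M l *ᵥ v ≠ 0 :=
  mulVec_ne_zero_of_mul_eq_smul hdet (bdryL_neg_mul c b hM l) hv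

/-- The second vector of a pair: the image of the partner `K(l) v` of `v`, which belongs to the
spectral parameter `-l`, under the Darboux matrix of `(l, v)`. -/
def pairVec (c : ℝ) (M : Matrix (Fin 2) (Fin 2) ℂ) (l : ℂ) (v : Fin 2 → ℂ) : Fin 2 → ℂ :=
  darbouxF l v (-l) *ᵥ (bdryL c M l *ᵥ v)

lemma pairVec_ne_zero (hM : M * M = (b : ℂ) • (1 : Matrix (Fin 2) (Fin 2) ℂ))
    (hdet : (4 * l ^ 2 - c) ^ 2 + 16 * l ^ 2 * b ≠ 0) (hv : v ≠ 0) (h0 : l ≠ 0)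
    (hre : -l ≠ conj l) : pairVec c M l v ≠ 0 :=
  darbouxF_mulVec_ne_zero (fun h => h0 (by linear_combination (-1 / 2 : ℂ) * h)) hre _
    (bdryL_mulVec_ne_zero hM hdet hv)

/-- The Darboux matrix of a pair of parameters `l, -l`. -/
def pairG (c : ℝ) (M : Matrix (Fin 2) (Fin 2) ℂ) (l : ℂ) (v : Fin 2 → ℂ) (z : ℂ) :
    Matrix (Fin 2) (Fin 2) ℂ :=
  darbouxF (-l) (pairVec c M l v) z * darbouxF l v z

/-- The transform of `M` under a pair of Darboux matrices. -/
def pairM (c : ℝ) (M : Matrix (Fin 2) (Fin 2) ℂ) (l : ℂ) (v : Fin 2 → ℂ) :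
    Matrix (Fin 2) (Fin 2) ℂ :=
  M - (2 * I * (l - conj l)) • (lineProj v - lineProj (pairVec c M l v))

/-- The defect of the intertwining relation is `z (A + z B)`: the choice of `pairM` cancels the
powers `z⁴` and `z³`, and the constant terms agree since `bdryL` is scalar at `z = 0`. -/
lemma intertwining_defect (A₀ A₁ M : Matrix (Fin 2) (Fin 2) ℂ) (c z : ℂ) :
    (-z • 1 - A₁) * (-z • 1 - A₀) * ((4 * z ^ 2 - c) • 1 + (4 * I * z) • M)
      - ((4 * z ^ 2 - c) • 1 + ((4 * I * z) • M + (8 * z) • (A₀ + A₁)))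
        * ((z • 1 - A₁) * (z • 1 - A₀))
      = z • ((-(2 * c)) • (A₀ + A₁) + (4 * I) • (A₁ * A₀ * M - M * (A₁ * A₀))
          - (8 : ℂ) • ((A₀ + A₁) * (A₁ * A₀))
        + z • ((4 * I) • ((A₀ + A₁) * M + M * (A₀ + A₁)) + (8 : ℂ) • ((A₀ + A₁) * (A₀ + A₁)))) := by
  simp only [mul_add, add_mul, mul_sub, sub_mul, Matrix.smul_mul, Matrix.mul_smul, one_mul,
    mul_one, smul_add, smul_sub, smul_smul, mul_assoc]
  module

/-- The boundary matrix intertwines the Darboux matrix of a pair at `z` and at `-z`. The defect is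
`z (A + z B)`; its zeros at `l, l*` give `A + z B = B F(z)` with the first Darboux matrix `F`, and
its zeros at `-l, -l*` show that `B` kills two orthogonal vectors. -/
theorem bdryL_pairM_mul (hM : M * M = (b : ℂ) • (1 : Matrix (Fin 2) (Fin 2) ℂ)) (hMh : Mᴴ = M)
    (hdet : (4 * l ^ 2 - c) ^ 2 + 16 * l ^ 2 * b ≠ 0) (hv : v ≠ 0) (h0 : l ≠ 0)
    (hre : -l ≠ conj l) (z : ℂ) :
    bdryL c (pairM c M l v) z * pairG c M l v z = pairG c M l v (-z) * bdryL c M z := by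
  set w := pairVec c M l v with hw
  have hw0 : w ≠ 0 := pairVec_ne_zero hM hdet hv h0 hre
  have h0' : conj l ≠ 0 := by simpa using h0
  have hdet' : (4 * conj l ^ 2 - c) ^ 2 + 16 * conj l ^ 2 * b ≠ 0 := by
    have h := (map_ne_zero (starRingEnd ℂ)).2 hdet
    simpa [map_ofNat] using h
  set A₀ : Matrix (Fin 2) (Fin 2) ℂ := conj l • 1 + (l - conj l) • lineProj v with hA₀
  set A₁ : Matrix (Fin 2) (Fin 2) ℂ := -(conj l • 1 + (l - conj l) • lineProj w) with hA₁
  have hF0 : ∀ z, darbouxF l v z = z • 1 - A₀ := fun z => by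
    rw [darbouxF, hA₀]; module
  have hF1 : ∀ z, darbouxF (-l) w z = z • 1 - A₁ := fun z => by
    rw [darbouxF, hA₁, map_neg]; module
  have hL2 : ∀ z, bdryL c (pairM c M l v) z
      = (4 * z ^ 2 - c) • 1 + ((4 * I * z) • M + (8 * z) • (A₀ + A₁)) := fun z => by
    rw [bdryL, pairM, ← hw, hA₀, hA₁]
    have hI := I_mul_I
    match_scalars <;> grind
  set R : ℂ → Matrix (Fin 2) (Fin 2) ℂ := fun z =>
    pairG c M l v (-z) * bdryL c M z - bdryL c (pairM c M l v) z * pairG c M l v z with hR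
  set A : Matrix (Fin 2) (Fin 2) ℂ := (-(2 * (c : ℂ))) • (A₀ + A₁)
    + (4 * I) • (A₁ * A₀ * M - M * (A₁ * A₀)) - (8 : ℂ) • ((A₀ + A₁) * (A₁ * A₀)) with hA
  set B : Matrix (Fin 2) (Fin 2) ℂ :=
    (4 * I) • ((A₀ + A₁) * M + M * (A₀ + A₁)) + (8 : ℂ) • ((A₀ + A₁) * (A₀ + A₁)) with hB
  have hRz : ∀ z, R z = z • (A + z • B) := fun z => by
    rw [hR]
    simp only [pairG, hL2, hF0]
    rw [← hw, hF1, hF1, bdryL]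
    exact intertwining_defect A₀ A₁ M c z
  set y := darbouxF l v (-conj l) *ᵥ (bdryL c M (conj l) *ᵥ orthVec v) with hy
  have hvp0 := orthVec_ne_zero hv
  have hy0 : y ≠ 0 := by
    refine darbouxF_mulVec_ne_zero (fun h => hre ?_) (fun h => h0' ?_) _
      (bdryL_mulVec_ne_zero hM hdet' hvp0)
    · linear_combination h
    · linear_combination (-1 / 2 : ℂ) * h
  have hwy : star w ⬝ᵥ y = 0 := by
    have e := conjTranspose_darbouxF_mul l v (-conj l)
    rw [map_neg, conj_conj] at e
    have e2 : (bdryL c M l)ᴴ * bdryL c M (conj l) = _ :=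
      (conjTranspose_bdryL c hMh l) ▸ bdryL_neg_mul c b hM (conj l)
    rw [hw, hy, pairVec, Matrix.star_mulVec, ← Matrix.dotProduct_mulVec, Matrix.mulVec_mulVec, e,
      Matrix.star_mulVec, ← Matrix.dotProduct_mulVec, Matrix.smul_mulVec, Matrix.one_mulVec,
      Matrix.mulVec_smul, Matrix.mulVec_mulVec, e2, Matrix.smul_mulVec, Matrix.one_mulVec,
      dotProduct_smul, dotProduct_smul, star_dotProduct_orthVec, smul_zero, smul_zero]
  have hF0v : darbouxF l v l *ᵥ v = 0 := darbouxF_self_mulVec l v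
  have hF0p : darbouxF l v (conj l) *ᵥ orthVec v = 0 := by
    rw [darbouxF_conj, Matrix.smul_mulVec, lineProj_mulVec, star_dotProduct_orthVec]
    simp
  have hG1 : pairG c M l v (-l) *ᵥ (bdryL c M l *ᵥ v) = 0 := by
    rw [pairG, ← Matrix.mulVec_mulVec]
    exact darbouxF_self_mulVec (-l) w
  have hG2 : pairG c M l v (-conj l) *ᵥ (bdryL c M (conj l) *ᵥ orthVec v) = 0 := by
    rw [pairG, ← Matrix.mulVec_mulVec, ← hy, ← hw, ← map_neg, darbouxF_conj, Matrix.smul_mulVec,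
      lineProj_mulVec, hwy]
    simp
  have hG3 : pairG c M l v l *ᵥ v = 0 := by
    rw [pairG, ← Matrix.mulVec_mulVec, hF0v, Matrix.mulVec_zero]
  have hG4 : pairG c M l v (conj l) *ᵥ orthVec v = 0 := by
    rw [pairG, ← Matrix.mulVec_mulVec, hF0p, Matrix.mulVec_zero]
  -- the zeros of the defect
  have r1 : R l *ᵥ v = 0 := by
    rw [hR, Matrix.sub_mulVec, ← Matrix.mulVec_mulVec, ← Matrix.mulVec_mulVec, hG1, hG3,
      Matrix.mulVec_zero, sub_zero]
  have r2 : R (conj l) *ᵥ orthVec v = 0 := by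
    rw [hR, Matrix.sub_mulVec, ← Matrix.mulVec_mulVec, ← Matrix.mulVec_mulVec, hG2, hG4,
      Matrix.mulVec_zero, sub_zero]
  have r3 : R (-l) *ᵥ (bdryL c M l *ᵥ v) = 0 := by
    rw [hR, Matrix.sub_mulVec, ← Matrix.mulVec_mulVec, ← Matrix.mulVec_mulVec _ (bdryL _ _ _),
      hG1, Matrix.mulVec_mulVec _ (bdryL c M _), bdryL_neg_mul c b hM, neg_neg, Matrix.smul_mulVec,
      Matrix.one_mulVec, Matrix.mulVec_smul, hG3, smul_zero, Matrix.mulVec_zero, sub_zero]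
  have r4 : R (-conj l) *ᵥ (bdryL c M (conj l) *ᵥ orthVec v) = 0 := by
    rw [hR, Matrix.sub_mulVec, ← Matrix.mulVec_mulVec, ← Matrix.mulVec_mulVec _ (bdryL _ _ _),
      hG2, Matrix.mulVec_mulVec _ (bdryL c M _), bdryL_neg_mul c b hM, neg_neg, Matrix.smul_mulVec,
      Matrix.one_mulVec, Matrix.mulVec_smul, hG4, smul_zero, Matrix.mulVec_zero, sub_zero]
  rw [hRz, Matrix.smul_mulVec] at r1 r2 r3 r4
  replace r1 := (smul_eq_zero.1 r1).resolve_left h0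
  replace r2 := (smul_eq_zero.1 r2).resolve_left h0'
  replace r3 := (smul_eq_zero.1 r3).resolve_left (neg_ne_zero.2 h0)
  replace r4 := (smul_eq_zero.1 r4).resolve_left (neg_ne_zero.2 h0')
  have a1 : A₀ *ᵥ v = l • v := by
    rw [hF0, Matrix.sub_mulVec, Matrix.smul_mulVec, Matrix.one_mulVec, sub_eq_zero] at hF0v
    exact hF0v.symm
  have a2 : A₀ *ᵥ orthVec v = conj l • orthVec v := by
    rw [hF0, Matrix.sub_mulVec, Matrix.smul_mulVec, Matrix.one_mulVec, sub_eq_zero] at hF0p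
    exact hF0p.symm
  have hC : A + B * A₀ = 0 := by
    refine eq_zero_of_mulVec_orthogonal hv hvp0 (star_dotProduct_orthVec v) ?_ ?_
    · rw [Matrix.add_mulVec, ← Matrix.mulVec_mulVec, a1, Matrix.mulVec_smul, ← Matrix.smul_mulVec,
        ← Matrix.add_mulVec, r1]
    · rw [Matrix.add_mulVec, ← Matrix.mulVec_mulVec, a2, Matrix.mulVec_smul, ← Matrix.smul_mulVec,
        ← Matrix.add_mulVec, r2]
  have hAB : ∀ z : ℂ, A + z • B = B * darbouxF l v z := fun z => by
    rw [hF0, mul_sub, Matrix.mul_smul, mul_one, eq_neg_of_add_eq_zero_left hC]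
    module
  rw [hAB, ← Matrix.mulVec_mulVec] at r3 r4
  have hB0 : B = 0 := eq_zero_of_mulVec_orthogonal hw0 hy0 hwy r3 r4
  have := hRz z
  rw [hAB, hB0, zero_mul, smul_zero] at this
  exact (sub_eq_zero.1 this).symm

end Pair

lemma darbouxF_smul {k : ℂ} (hk : k ≠ 0) (m : ℂ) (v : Fin 2 → ℂ) (z : ℂ) :
    darbouxF m (k • v) z = darbouxF m v z := by
  rw [darbouxF, lineProj_smul hk, darbouxF]

section Pair

variable {c b : ℝ} {M : Matrix (Fin 2) (Fin 2) ℂ} {l : ℂ} {v : Fin 2 → ℂ}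

/-- The Darboux matrix of a pair can be cancelled away from the zeros of its determinant. -/
lemma eq_zero_of_mul_pairG {X : Matrix (Fin 2) (Fin 2) ℂ} {z : ℂ} (h1 : z ≠ l) (h2 : z ≠ conj l)
    (h3 : z ≠ -l) (h4 : z ≠ -conj l) (h : X * pairG c M l v z = 0) : X = 0 := by
  have e := congrArg (fun Y => Y * ((darbouxF l v (conj z))ᴴ
    * (darbouxF (-l) (pairVec c M l v) (conj z))ᴴ)) h
  have h3' : z - -l ≠ 0 := sub_ne_zero.2 h3
  have h4' : z - conj (-l) ≠ 0 := by rw [map_neg]; exact sub_ne_zero.2 h4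
  simp only [pairG, zero_mul] at e
  rw [Matrix.mul_assoc, Matrix.mul_assoc, ← Matrix.mul_assoc (darbouxF l v z),
    darbouxF_mul_conjTranspose, Matrix.smul_mul, one_mul, Matrix.mul_smul,
    darbouxF_mul_conjTranspose, smul_smul, Matrix.mul_smul, mul_one] at e
  exact (smul_eq_zero.1 e).resolve_left
    (mul_ne_zero (mul_ne_zero (sub_ne_zero.2 h1) (sub_ne_zero.2 h2)) (mul_ne_zero h3' h4'))

lemma bdryL_neg_mul_self (c : ℝ) (M : Matrix (Fin 2) (Fin 2) ℂ) :
    bdryL c M (-1) * bdryL c M 1 = ((4 - c : ℂ) ^ 2) • (1 : Matrix (Fin 2) (Fin 2) ℂ)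
      + (16 : ℂ) • (M * M) := by
  have hI := I_mul_I
  simp only [bdryL, mul_add, add_mul, Matrix.smul_mul, Matrix.mul_smul, one_mul, mul_one, smul_smul]
  match_scalars
  · ring
  · ring
  · linear_combination (-16 : ℂ) * hI

lemma ne_of_im_ne_zero {l : ℂ} (him : l.im ≠ 0) :
    (1 : ℂ) ≠ l ∧ (1 : ℂ) ≠ conj l ∧ (1 : ℂ) ≠ -l ∧ (1 : ℂ) ≠ -conj l := by
  refine ⟨?_, ?_, ?_, ?_⟩ <;> intro h <;> have h' := congrArg Complex.im h <;>
    simp at h' <;> exact him (by linarith)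

/-- The pair transform preserves the square of the coefficient matrix. -/
lemma pairM_mul_self (hM : M * M = (b : ℂ) • (1 : Matrix (Fin 2) (Fin 2) ℂ)) (hMh : Mᴴ = M)
    (hdet : (4 * l ^ 2 - c) ^ 2 + 16 * l ^ 2 * b ≠ 0) (hv : v ≠ 0) (h0 : l ≠ 0)
    (hre : -l ≠ conj l) (him : l.im ≠ 0) :
    pairM c M l v * pairM c M l v = (b : ℂ) • (1 : Matrix (Fin 2) (Fin 2) ℂ) := by
  obtain ⟨h1, h2, h3, h4⟩ := ne_of_im_ne_zero him
  have e1 := bdryL_pairM_mul hM hMh hdet hv h0 hre 1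
  have e2 := bdryL_pairM_mul hM hMh hdet hv h0 hre (-1)
  rw [neg_neg] at e2
  have e3 : (bdryL c (pairM c M l v) (-1) * bdryL c (pairM c M l v) 1
      - bdryL c M (-1) * bdryL c M 1) * pairG c M l v 1 = 0 := by
    rw [sub_mul, Matrix.mul_assoc, e1, ← Matrix.mul_assoc, e2, Matrix.mul_assoc,
      bdryL_neg_mul c b hM]
    simp
  have e4 := eq_zero_of_mul_pairG h1 h2 h3 h4 e3
  rw [bdryL_neg_mul_self, bdryL_neg_mul_self, hM, add_sub_add_left_eq_sub, ← smul_sub] at e4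
  exact sub_eq_zero.1 ((smul_eq_zero.1 e4).resolve_left (by norm_num))

lemma neg_two_I_mul_sub_conj (l : ℂ) : -(2 * I * (l - conj l)) = ((4 * l.im : ℝ) : ℂ) := by
  rw [Complex.sub_conj]
  push_cast
  linear_combination (-4 * (l.im : ℂ)) * I_mul_I

lemma lineProj_diag_re (v : Fin 2 → ℂ) (i : Fin 2) : ((lineProj v i i).re : ℂ) = lineProj v i i :=
  Complex.conj_eq_iff_re.1 (conj_lineProj_diag v i)

lemma pairM_bdryM {q : ℂ} {om : ℝ} {w : Fin 2 → ℂ} (hv : v ≠ 0) (hw0 : w ≠ 0)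
    (hw : lineProj w = lineProj (pairVec c (bdryM q om) l v)) :
    pairM c (bdryM q om) l v
      = bdryM (q - 2 * I * (l - conj l) * lineProj v 0 1
          - 2 * I * (-l - conj (-l)) * lineProj w 0 1)
        (om + 4 * l.im * ((lineProj v 0 0).re - (lineProj w 0 0).re)) := by
  have h1 := lineProj_one_one hv
  have h2 := lineProj_one_one hw0
  have h3 := neg_two_I_mul_sub_conj l
  rw [pairM, ← hw]
  ext i j
  fin_cases i <;> fin_cases j <;>
    simp [bdryM, h1, h2, lineProj_one_zero, lineProj_diag_re, map_ofNat] <;>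
    push_cast at h3 <;> grind

end Pair

/-! ### The boundary condition as an evolution equation -/

/-- The boundary condition at time `t`, with `c = α² + β²`, as an evolution equation for the
coefficient matrix `M`: `M_t = [V(0), M] - i c Q`. -/
def BdryEvolution (c : ℝ) (u : ℝ → ℝ → ℂ) (Ω : ℝ → ℝ) (t : ℝ) : Prop :=
  ∀ i j : Fin 2, HasDerivWithinAt (fun s => bdryM (u s 0) (Ω s) i j)
    ((laxV u 0 t 0 * bdryM (u t 0) (Ω t) - bdryM (u t 0) (Ω t) * laxV u 0 t 0
      - (I * c) • potQ (u t 0)) i j) (Ici 0) t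

/-- The right hand side of the boundary constraint is linear in the spectral parameter. -/
lemma laxV_mul_bdryL (c : ℝ) (u : ℝ → ℝ → ℂ) (om t : ℝ) (z : ℂ) :
    laxV u (-z) t 0 * bdryL c (bdryM (u t 0) om) z - bdryL c (bdryM (u t 0) om) z * laxV u z t 0
      = (4 * I * z) • (laxV u 0 t 0 * bdryM (u t 0) om - bdryM (u t 0) om * laxV u 0 t 0
        - (I * c) • potQ (u t 0)) := by
  have hI := I_mul_I
  ext i j
  fin_cases i <;> fin_cases j <;>
  simp only [laxV_eq, Matrix.sub_apply, Matrix.add_apply, Matrix.smul_apply, bdryL, bdryM, potQ,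
    Matrix.mul_apply, Fin.sum_univ_two, Matrix.of_apply, Matrix.cons_val_zero, Matrix.cons_val_one,
    smul_eq_mul, Fin.zero_eta, Fin.mk_one, Matrix.one_apply_eq, Matrix.one_apply_ne, ne_eq,
    zero_ne_one, one_ne_zero, not_false_eq_true] <;>
  grind

lemma hasDerivWithinAt_bdryL_apply {c : ℝ} {M : ℝ → Matrix (Fin 2) (Fin 2) ℂ}
    {M' : Matrix (Fin 2) (Fin 2) ℂ} {t : ℝ} {i j : Fin 2}
    (h : HasDerivWithinAt (fun s => M s i j) (M' i j) (Ici 0) t) (z : ℂ) :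
    HasDerivWithinAt (fun s => bdryL c (M s) z i j) (((4 * I * z) • M') i j) (Ici 0) t :=
  (h.const_mul _).const_add _

lemma bdryEvolution_of_isNewBoundary {α β : ℝ} (hβ : β ≠ 0) {u : ℝ → ℝ → ℂ} {Ω : ℝ → ℝ}
    (h : IsNewBoundary α β u Ω) {t : ℝ} (ht : 0 ≤ t) :
    BdryEvolution (α ^ 2 + β ^ 2) u Ω t := by
  intro i j
  -- the spectral parameter `1` is not a pole
  have hd : (2 * 1 - I * (|β| : ℝ)) ^ 2 - (α : ℂ) ^ 2 ≠ 0 := by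
    intro h0
    have h1 := congrArg Complex.im h0
    simp [pow_two] at h1
    exact hβ (abs_eq_zero.1 (by linarith))
  have h1 := h.constraint 1 hd t ht i j
  simp only [bdryK_eq] at h1
  rw [Matrix.mul_smul, Matrix.smul_mul, ← smul_sub, laxV_mul_bdryL] at h1
  have hI : (4 * I : ℂ) ≠ 0 := by simp
  generalize (2 * 1 - I * (|β| : ℝ)) ^ 2 - (α : ℂ) ^ 2 = d at hd h1
  have h2 := ((h1.const_mul d).sub_const
    ((4 * (1 : ℂ) ^ 2 - (α ^ 2 + β ^ 2 : ℝ)) * (1 : Matrix (Fin 2) (Fin 2) ℂ) i j)).const_mul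
    (4 * I)⁻¹
  refine (h2.congr_deriv ?_).congr_of_eventuallyEq (Eventually.of_forall fun s => ?_) ?_
  · simp only [Matrix.smul_apply, smul_eq_mul, mul_one]
    field_simp
  all_goals
    simp only [bdryL, Matrix.smul_apply, Matrix.add_apply, smul_eq_mul, mul_one]
    field_simp
    ring

lemma BdryEvolution.constraint {α β : ℝ} {u : ℝ → ℝ → ℂ} {Ω : ℝ → ℝ} {t : ℝ}
    (h : BdryEvolution (α ^ 2 + β ^ 2) u Ω t) (z : ℂ) (i j : Fin 2) :
    HasDerivWithinAt (fun s => bdryK α β (u s 0) (Ω s) z i j)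
        ((laxV u (-z) t 0 * bdryK α β (u t 0) (Ω t) z
          - bdryK α β (u t 0) (Ω t) z * laxV u z t 0) i j) (Ici 0) t := by
  simp only [bdryK_eq]
  rw [Matrix.mul_smul, Matrix.smul_mul, ← smul_sub, laxV_mul_bdryL]
  exact (hasDerivWithinAt_bdryL_apply (h i j) z).const_mul _

lemma hasDerivWithinAt_mul_apply {A B : ℝ → Matrix (Fin 2) (Fin 2) ℂ}
    {A' B' : Matrix (Fin 2) (Fin 2) ℂ} {S : Set ℝ} {t : ℝ}
    (hA : ∀ i j, HasDerivWithinAt (fun s => A s i j) (A' i j) S t)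
    (hB : ∀ i j, HasDerivWithinAt (fun s => B s i j) (B' i j) S t) (i j : Fin 2) :
    HasDerivWithinAt (fun s => (A s * B s) i j) ((A' * B t + A t * B') i j) S t := by
  simp only [Matrix.mul_apply, Matrix.add_apply, Fin.sum_univ_two]
  refine (((hA i 0).mul (hB 0 j)).add ((hA i 1).mul (hB 1 j))).congr_deriv ?_
  ring

lemma gauge_comp (W₂ W₁ W₀ F₁ F₀ : Matrix (Fin 2) (Fin 2) ℂ) :
    (W₂ * F₁ - F₁ * W₁) * F₀ + F₁ * (W₁ * F₀ - F₀ * W₀)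
      = W₂ * (F₁ * F₀) - F₁ * F₀ * W₀ := by
  noncomm_ring

/-- The transform of `Ω` under a pair of Darboux matrices. -/
def pairOm (Ω : ℝ → ℝ) (l : ℂ) (φ₀ φ₁ : ℝ → ℝ → Fin 2 → ℂ) (t : ℝ) : ℝ :=
  Ω t + 4 * l.im * ((lineProj (φ₀ t 0) 0 0).re - (lineProj (φ₁ t 0) 0 0).re)

/-- The boundary evolution is preserved by a pair of elementary Darboux transformations at `l, -l`
whose Lax solutions are related by the boundary matrix. -/
theorem bdryEvolution_pair {c b : ℝ} {u : ℝ → ℝ → ℂ} {Ω : ℝ → ℝ} {l k : ℂ}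
    {φ₀ φ₁ : ℝ → ℝ → Fin 2 → ℂ} (hu : IsNLSSolution u)
    (hφ₀ : IsLaxSolution u l φ₀) (h₀ : ∀ t x : ℝ, 0 ≤ t → 0 ≤ x → φ₀ t x ≠ 0)
    (hφ₁ : IsLaxSolution (darbouxU u l φ₀) (-l) φ₁)
    (h₁ : ∀ t x : ℝ, 0 ≤ t → 0 ≤ x → φ₁ t x ≠ 0) (hk : k ≠ 0)
    (hpair : ∀ t, 0 ≤ t → φ₁ t 0 = k • pairVec c (bdryM (u t 0) (Ω t)) l (φ₀ t 0))
    (hsq : ∀ t, 0 ≤ t → Ω t ^ 2 + ‖u t 0‖ ^ 2 = b)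
    (hdet : (4 * l ^ 2 - c) ^ 2 + 16 * l ^ 2 * b ≠ 0) (h0 : l ≠ 0)
    (hre : -l ≠ conj l) (him : l.im ≠ 0)
    (hevol : ∀ t, 0 ≤ t → BdryEvolution c u Ω t) {t : ℝ} (ht : 0 ≤ t) :
    BdryEvolution c (darbouxU (darbouxU u l φ₀) (-l) φ₁) (pairOm Ω l φ₀ φ₁) t := by
  set u₂ := darbouxU (darbouxU u l φ₀) (-l) φ₁ with hu₂
  set Ω₂ := pairOm Ω l φ₀ φ₁ with hΩ₂
  have hM : ∀ s, 0 ≤ s → bdryM (u s 0) (Ω s) * bdryM (u s 0) (Ω s)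
      = (b : ℂ) • (1 : Matrix (Fin 2) (Fin 2) ℂ) := fun s hs => by
    rw [bdryM_mul_self, hsq s hs]
  have hP : ∀ s, 0 ≤ s → lineProj (φ₁ s 0)
      = lineProj (pairVec c (bdryM (u s 0) (Ω s)) l (φ₀ s 0)) := fun s hs => by
    rw [hpair s hs, lineProj_smul hk]
  have hM₂ : ∀ s, 0 ≤ s → pairM c (bdryM (u s 0) (Ω s)) l (φ₀ s 0) = bdryM (u₂ s 0) (Ω₂ s) :=
    fun s hs => pairM_bdryM (h₀ s 0 hs le_rfl) (h₁ s 0 hs le_rfl) (hP s hs)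
  set G : ℂ → ℝ → Matrix (Fin 2) (Fin 2) ℂ := fun z s =>
    darbouxF (-l) (φ₁ s 0) z * darbouxF l (φ₀ s 0) z with hG
  have hGe : ∀ z s, 0 ≤ s → G z s = pairG c (bdryM (u s 0) (Ω s)) l (φ₀ s 0) z :=
    fun z s hs => by
      rw [hG, pairG]
      simp only
      rw [hpair s hs, darbouxF_smul hk]
  have hu₁ := isNLSSolution_darbouxU hu hφ₀ h₀
  -- derivatives of the factors
  have dG : ∀ z i j, HasDerivWithinAt (fun s => G z s i j)
      ((laxV u₂ z t 0 * G z t - G z t * laxV u z t 0) i j) (Ici 0) t := fun z i j => by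
    refine (hasDerivWithinAt_mul_apply
      (hasDerivWithinAt_darbouxF_t hu₁ hφ₁ ht le_rfl (h₁ t 0 ht le_rfl) z)
      (hasDerivWithinAt_darbouxF_t hu hφ₀ ht le_rfl (h₀ t 0 ht le_rfl) z) i j).congr_deriv ?_
    simp only [hG, ← hu₂, gauge_comp]
  have dK : ∀ z i j, HasDerivWithinAt (fun s => bdryL c (bdryM (u s 0) (Ω s)) z i j)
      ((laxV u (-z) t 0 * bdryL c (bdryM (u t 0) (Ω t)) z
        - bdryL c (bdryM (u t 0) (Ω t)) z * laxV u z t 0) i j) (Ici 0) t := fun z i j => by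
    rw [laxV_mul_bdryL]
    exact hasDerivWithinAt_bdryL_apply (hevol t ht i j) z
  obtain ⟨M₂', dM₂⟩ : ∃ M₂' : Matrix (Fin 2) (Fin 2) ℂ, ∀ i j,
      HasDerivWithinAt (fun s => bdryM (u₂ s 0) (Ω₂ s) i j) (M₂' i j) (Ici 0) t := by
    have hd : ∀ i j, DifferentiableWithinAt ℝ (fun s => bdryM (u₂ s 0) (Ω₂ s) i j) (Ici 0) t := by
      intro i j
      have d := ((hevol t ht i j).sub
        (((hasDerivWithinAt_lineProj (hφ₀.t_part t 0 ht le_rfl) (h₀ t 0 ht le_rfl) i j).sub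
          (hasDerivWithinAt_lineProj (hφ₁.t_part t 0 ht le_rfl) (h₁ t 0 ht le_rfl) i j)).const_mul
          (2 * I * (l - conj l)))).differentiableWithinAt
      have e : ∀ s, 0 ≤ s → bdryM (u₂ s 0) (Ω₂ s) i j = bdryM (u s 0) (Ω s) i j
          - 2 * I * (l - conj l) * (lineProj (φ₀ s 0) i j - lineProj (φ₁ s 0) i j) :=
        fun s hs => by
          rw [← hM₂ s hs, pairM, ← hP s hs]
          rfl
      exact d.congr (fun s hs => e s hs) (e t ht)
    exact ⟨fun i j => derivWithin (fun s => bdryM (u₂ s 0) (Ω₂ s) i j) (Ici 0) t,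
      fun i j => (hd i j).hasDerivWithinAt⟩
  have hinter : ∀ s, 0 ≤ s → bdryL c (bdryM (u₂ s 0) (Ω₂ s)) 1 * G 1 s
      = G (-1) s * bdryL c (bdryM (u s 0) (Ω s)) 1 := fun s hs => by
    rw [hGe _ s hs, hGe _ s hs, ← hM₂ s hs]
    exact bdryL_pairM_mul (hM s hs) (conjTranspose_bdryM _ _) hdet (h₀ s 0 hs le_rfl) h0 hre 1
  -- differentiate the intertwining relation at the spectral parameter `1`
  have e1 := hasDerivWithinAt_mul_apply (fun i j => hasDerivWithinAt_bdryL_apply (c := c)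
    (dM₂ i j) 1) (dG 1)
  have e2 := hasDerivWithinAt_mul_apply (dG (-1)) (dK 1)
  have e3 : (4 * I * 1) • M₂' * G 1 t + bdryL c (bdryM (u₂ t 0) (Ω₂ t)) 1
        * (laxV u₂ 1 t 0 * G 1 t - G 1 t * laxV u 1 t 0)
      = (laxV u₂ (-1) t 0 * G (-1) t - G (-1) t * laxV u (-1) t 0)
          * bdryL c (bdryM (u t 0) (Ω t)) 1
        + G (-1) t * (laxV u (-1) t 0 * bdryL c (bdryM (u t 0) (Ω t)) 1
          - bdryL c (bdryM (u t 0) (Ω t)) 1 * laxV u 1 t 0) := by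
    ext i j
    refine (uniqueDiffOn_Ici (0 : ℝ) t ht).eq_deriv _ (e1 i j) ((e2 i j).congr ?_ ?_)
    · exact fun s hs => by rw [hinter s hs]
    · rw [hinter t ht]
  have e4 : ((4 * I * 1) • M₂' - (laxV u₂ (-1) t 0 * bdryL c (bdryM (u₂ t 0) (Ω₂ t)) 1
      - bdryL c (bdryM (u₂ t 0) (Ω₂ t)) 1 * laxV u₂ 1 t 0)) * G 1 t = 0 := by
    have h := hinter t ht
    have e5 : (4 * I * 1) • M₂' * G 1 t = laxV u₂ (-1) t 0 * (G (-1) t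
        * bdryL c (bdryM (u t 0) (Ω t)) 1) - (G (-1) t * bdryL c (bdryM (u t 0) (Ω t)) 1)
        * laxV u 1 t 0 - bdryL c (bdryM (u₂ t 0) (Ω₂ t)) 1
        * (laxV u₂ 1 t 0 * G 1 t - G 1 t * laxV u 1 t 0) := by
      rw [eq_sub_iff_add_eq, e3]
      noncomm_ring
    rw [sub_mul, e5, ← h]
    noncomm_ring
  obtain ⟨n1, n2, n3, n4⟩ := ne_of_im_ne_zero him
  rw [hGe 1 t ht] at e4
  have e6 := eq_zero_of_mul_pairG n1 n2 n3 n4 e4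
  rw [laxV_mul_bdryL, ← smul_sub] at e6
  have e7 := sub_eq_zero.1 ((smul_eq_zero.1 e6).resolve_left (by simp))
  intro i j
  rw [← e7]
  exact dM₂ i j

/-! ### Asymptotic directions at the boundary -/

/-- If `p ∈ [0, 1]` solves an integrable perturbation of the logistic equation `p' = K (p - p²)`,
`K > 0`, it converges to an equilibrium: up to an integral that converges, `p` is monotone, and
its limit `L` makes the integrable function `p - p²` converge to `L - L²`. -/
lemma tendsto_of_perturbed_logistic_pos {p e : ℝ → ℝ} {K : ℝ} (hK : 0 < K)
    (hp : ∀ t, 0 ≤ t → p t ∈ Icc (0 : ℝ) 1)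
    (hd : ∀ t, 0 ≤ t → HasDerivWithinAt p (K * (p t - p t ^ 2) + e t) (Ici 0) t)
    (he : ContinuousOn e (Ici 0)) (hei : IntegrableOn e (Ioi 0)) :
    Tendsto p atTop (𝓝 0) ∨ Tendsto p atTop (𝓝 1) := by
  set E : ℝ → ℝ := fun t => ∫ s in (0 : ℝ)..t, e s with hE
  have hEi : ∀ t, 0 ≤ t → IntervalIntegrable e volume 0 t := fun t ht =>
    (intervalIntegrable_iff_integrableOn_Ioc_of_le ht).2 (hei.mono_set Ioc_subset_Ioi_self)
  have hElim := intervalIntegral_tendsto_integral_Ioi (0 : ℝ) hei tendsto_id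
  have hEd : ∀ t ∈ Ioi (0 : ℝ), HasDerivAt E (e t) t := fun t ht =>
    intervalIntegral.integral_hasDerivAt_right (hEi t (le_of_lt ht))
      (he.stronglyMeasurableAtFilter_nhdsWithin measurableSet_Ici t |>.filter_mono
        (by rw [nhdsWithin_eq_nhds.2 (Ici_mem_nhds ht)]))
      (he.continuousAt (Ici_mem_nhds ht))
  have hEc : ContinuousOn E (Ici 0) := by
    intro t ht
    rcases eq_or_lt_of_le (mem_Ici.1 ht) with h | h
    · have h1 : IntegrableOn e (Icc 0 1) :=
        (integrableOn_Icc_iff_integrableOn_Ioc).2 (hei.mono_set Ioc_subset_Ioi_self)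
      have h2 := intervalIntegral.continuousOn_primitive_interval (μ := volume) (f := e)
        (a := 0) (b := 1) (by rwa [uIcc_of_le zero_le_one])
      rw [uIcc_of_le zero_le_one] at h2
      rw [← h]
      refine (h2 0 ⟨le_rfl, zero_le_one⟩).mono_of_mem_nhdsWithin ?_
      exact mem_nhdsWithin.2 ⟨Iio 1, isOpen_Iio, by norm_num,
        fun x hx => ⟨hx.2, le_of_lt hx.1⟩⟩
    · exact (hEd t h).continuousAt.continuousWithinAt
  set g : ℝ → ℝ := fun t => p t - E t with hg
  have hgd : ∀ t ∈ Ioi (0 : ℝ), HasDerivAt g (K * (p t - p t ^ 2)) t := fun t ht => by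
    refine (((hd t (le_of_lt ht)).hasDerivAt (Ici_mem_nhds ht)).sub (hEd t ht)).congr_deriv ?_
    ring
  have hgc : ContinuousOn g (Ici 0) :=
    ContinuousOn.sub (fun t ht => (hd t ht).continuousWithinAt) hEc
  have hpos : ∀ t, 0 ≤ t → 0 ≤ K * (p t - p t ^ 2) := fun t ht => by
    have := hp t ht
    have : 0 ≤ p t * (1 - p t) := mul_nonneg this.1 (by linarith [this.2])
    exact mul_nonneg hK.le (by nlinarith)
  have hmono : MonotoneOn g (Ici 0) := by
    refine monotoneOn_of_deriv_nonneg (convex_Ici 0) hgc ?_ ?_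
    · rw [interior_Ici]
      exact fun t ht => (hgd t ht).differentiableAt.differentiableWithinAt
    · rw [interior_Ici]
      exact fun t ht => (hgd t ht).deriv ▸ hpos t (le_of_lt ht)
  have hEb : ∀ t, 0 ≤ t → |E t| ≤ ∫ s in Ioi (0 : ℝ), ‖e s‖ := fun t ht => by
    rw [hE, ← Real.norm_eq_abs]
    refine (intervalIntegral.norm_integral_le_integral_norm_uIoc).trans ?_
    rw [uIoc_of_le ht]
    exact setIntegral_mono_set hei.norm (Eventually.of_forall fun _ => norm_nonneg _)
      (Ioc_subset_Ioi_self.eventuallyLE)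
  have hmax : Monotone fun t => g (max t 0) := fun a b hab =>
    hmono (mem_Ici.2 (le_max_right _ _)) (mem_Ici.2 (le_max_right _ _)) (max_le_max hab le_rfl)
  have hbdd : BddAbove (range fun t => g (max t 0)) := by
    refine ⟨1 + ∫ s in Ioi (0 : ℝ), ‖e s‖, ?_⟩
    rintro _ ⟨t, rfl⟩
    have h1 := hp (max t 0) (le_max_right _ _)
    have h2 := hEb (max t 0) (le_max_right _ _)
    have h3 := neg_abs_le (E (max t 0))
    simp only [hg]
    linarith [h1.2]
  have hglim : Tendsto g atTop (𝓝 (⨆ t, g (max t 0))) := by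
    refine (tendsto_atTop_ciSup hmax hbdd).congr' ?_
    filter_upwards [eventually_ge_atTop (0 : ℝ)] with t ht
    rw [max_eq_left ht]
  set L := (⨆ t, g (max t 0)) + ∫ s in Ioi (0 : ℝ), e s with hL
  have hplim : Tendsto p atTop (𝓝 L) := by
    refine (hglim.add hElim).congr fun t => ?_
    simp [hg, hE]
  have hint := integrableOn_Ioi_deriv_of_nonneg (hgc 0 (mem_Ici.2 le_rfl)) hgd
    (fun t ht => hpos t (le_of_lt ht)) hglim
  have hlim : Tendsto (fun t => K * (p t - p t ^ 2)) atTop (𝓝 (K * (L - L ^ 2))) :=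
    (hplim.sub (hplim.pow 2)).const_mul K
  have h0 : K * (L - L ^ 2) = 0 := by
    refine IntegrableAtFilter.eq_zero_of_tendsto (μ := volume) (l := atTop)
      ⟨Ioi 0, Ioi_mem_atTop 0, hint⟩ (fun s hs => ?_) hlim
    obtain ⟨a, ha⟩ := mem_atTop_sets.1 hs
    exact measure_mono_top (s₁ := Ici a) (fun x hx => ha x hx) Real.volume_Ici
  have h1 : L * (1 - L) = 0 := by
    have := (mul_eq_zero.1 h0).resolve_left hK.ne'
    linear_combination this
  rcases mul_eq_zero.1 h1 with h | h
  · exact Or.inl (h ▸ hplim)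
  · exact Or.inr ((show L = 1 by linarith) ▸ hplim)

lemma tendsto_of_perturbed_logistic {p e : ℝ → ℝ} {K : ℝ} (hK : K ≠ 0)
    (hp : ∀ t, 0 ≤ t → p t ∈ Icc (0 : ℝ) 1)
    (hd : ∀ t, 0 ≤ t → HasDerivWithinAt p (K * (p t - p t ^ 2) + e t) (Ici 0) t)
    (he : ContinuousOn e (Ici 0)) (hei : IntegrableOn e (Ioi 0)) :
    Tendsto p atTop (𝓝 0) ∨ Tendsto p atTop (𝓝 1) := by
  rcases hK.lt_or_gt with h | h
  · have key := tendsto_of_perturbed_logistic_pos (p := fun t => 1 - p t) (e := fun t => -e t)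
      (neg_pos.2 h)
      (fun t ht => ⟨by linarith [(hp t ht).2], by linarith [(hp t ht).1]⟩)
      (fun t ht => ((hd t ht).const_sub 1).congr_deriv (by ring)) he.neg hei.neg
    rcases key with k | k
    · right
      simpa using k.const_sub 1
    · left
      simpa using k.const_sub 1
  · exact tendsto_of_perturbed_logistic_pos h hp hd he hei

/-- The line of `χ t` converges to the `s`-th coordinate axis as `t → ∞`. -/
def AsympDir (χ : ℝ → Fin 2 → ℂ) (s : Fin 2) : Prop :=
  Tendsto (fun t => lineProj (χ t)) atTop (𝓝 (Matrix.single s s 1))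

lemma tendsto_matrix_iff {f : ℝ → Matrix (Fin 2) (Fin 2) ℂ} {A : Matrix (Fin 2) (Fin 2) ℂ}
    {l : Filter ℝ} : Tendsto f l (𝓝 A) ↔ ∀ i j, Tendsto (fun t => f t i j) l (𝓝 (A i j)) := by
  refine (tendsto_pi_nhds (f := f)).trans (forall_congr' fun i => ?_)
  exact tendsto_pi_nhds

lemma AsympDir.congr {χ χ' : ℝ → Fin 2 → ℂ} {s : Fin 2} (h : AsympDir χ s)
    (he : ∀ t, 0 ≤ t → lineProj (χ' t) = lineProj (χ t)) : AsympDir χ' s := by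
  refine Tendsto.congr' ?_ h
  filter_upwards [eventually_ge_atTop (0 : ℝ)] with t ht
  exact (he t ht).symm

/-- Matrices with an invertible diagonal limit preserve asymptotic directions. -/
lemma AsympDir.mulVec {χ : ℝ → Fin 2 → ℂ} {s : Fin 2} (h : AsympDir χ s)
    (hχ : ∀ t, 0 ≤ t → χ t ≠ 0) {T : ℝ → Matrix (Fin 2) (Fin 2) ℂ} {d : Fin 2 → ℂ}
    (hT : Tendsto T atTop (𝓝 (Matrix.diagonal d))) (hd : d s ≠ 0) :
    AsympDir (fun t => T t *ᵥ χ t) s := by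
  have hTh : Tendsto (fun t => (T t)ᴴ) atTop (𝓝 (Matrix.diagonal d)ᴴ) :=
    (continuous_id.matrix_conjTranspose.tendsto _).comp hT
  have hN := (hT.mul h).mul hTh
  have eN : Matrix.diagonal d * Matrix.single s s (1 : ℂ) * (Matrix.diagonal d)ᴴ
      = (d s * conj (d s)) • Matrix.single s s (1 : ℂ) := by
    ext i j
    fin_cases s <;> fin_cases i <;> fin_cases j <;>
      simp [Matrix.mul_apply, Fin.sum_univ_two, Matrix.diagonal_apply, Matrix.single_apply]
  rw [eN] at hN
  have htr := (continuous_id.matrix_trace.tendsto _).comp hN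
  have hds : d s * conj (d s) ≠ 0 := mul_ne_zero hd (by simpa using hd)
  have etr : Matrix.trace ((d s * conj (d s)) • Matrix.single s s (1 : ℂ)) = d s * conj (d s) := by
    rw [Matrix.trace_smul, Matrix.trace_single_eq_same, smul_eq_mul, mul_one]
  simp only [id, etr, Function.comp_def] at htr
  have hfin := (htr.inv₀ hds).smul hN
  rw [smul_smul, inv_mul_cancel₀ hds, one_smul] at hfin
  refine hfin.congr' ?_
  filter_upwards [eventually_ge_atTop (0 : ℝ)] with t ht
  exact (lineProj_mulVec_eq (T t) (hχ t ht)).symm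

lemma AsympDir.tendsto_darbouxF {φ : ℝ → Fin 2 → ℂ} {s : Fin 2} (h : AsympDir φ s) (m z : ℂ) :
    Tendsto (fun t => darbouxF m (φ t) z) atTop
      (𝓝 (Matrix.diagonal fun i => if i = s then z - m else z - conj m)) := by
  have h1 := (h.const_smul (conj m - m)).const_add
    ((z - conj m) • (1 : Matrix (Fin 2) (Fin 2) ℂ))
  have e : (z - conj m) • (1 : Matrix (Fin 2) (Fin 2) ℂ) + (conj m - m) • Matrix.single s s (1 : ℂ)
      = Matrix.diagonal fun i => if i = s then z - m else z - conj m := by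
    ext i j
    fin_cases s <;> fin_cases i <;> fin_cases j <;> simp [Matrix.single_apply]
  rwa [e] at h1

/-- A nonvanishing dressed vector has an asymptotic direction: that of the vector itself if the
Darboux matrix has an invertible limit, and that of the dressing vector if the spectral parameter
is the conjugate of the dressing parameter. -/
lemma AsympDir.darbouxF_mulVec {φ χ : ℝ → Fin 2 → ℂ} {s r : Fin 2} (h : AsympDir φ s)
    (hχ : AsympDir χ r) (hχ0 : ∀ t, 0 ≤ t → χ t ≠ 0) {m z : ℂ} (hz : z ≠ m)
    (h0 : ∀ t, 0 ≤ t → darbouxF m (φ t) z *ᵥ χ t ≠ 0) :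
    ∃ q, AsympDir (fun t => darbouxF m (φ t) z *ᵥ χ t) q := by
  by_cases hc : z = conj m
  · refine ⟨s, h.congr fun t ht => ?_⟩
    have h1 := h0 t ht
    rw [hc, darbouxF_conj, Matrix.smul_mulVec, lineProj_mulVec, smul_smul] at h1 ⊢
    exact lineProj_smul (left_ne_zero_of_smul h1) _
  · refine ⟨r, hχ.mulVec hχ0 (h.tendsto_darbouxF m z) ?_⟩
    split_ifs
    · exact sub_ne_zero.2 hz
    · exact sub_ne_zero.2 hc

lemma tendsto_bdryL {u : ℝ → ℂ} {Ω : ℝ → ℝ} {B : ℝ} (hu : Tendsto u atTop (𝓝 0))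
    (hΩ : Tendsto Ω atTop (𝓝 B)) (c : ℝ) (z : ℂ) :
    Tendsto (fun t => bdryL c (bdryM (u t) (Ω t)) z) atTop
      (𝓝 (Matrix.diagonal ![4 * z ^ 2 - c + 4 * I * z * B, 4 * z ^ 2 - c - 4 * I * z * B])) := by
  have hΩ' : Tendsto (fun t => (Ω t : ℂ)) atTop (𝓝 (B : ℂ)) :=
    (continuous_ofReal.tendsto B).comp hΩ
  have hu' : Tendsto (fun t => conj (u t)) atTop (𝓝 0) := by
    simpa [Function.comp_def] using (continuous_conj.tendsto 0).comp hu
  rw [tendsto_matrix_iff]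
  intro i j
  fin_cases i <;> fin_cases j <;> simp [bdryL, bdryM]
  · exact (hΩ'.const_mul _).const_add _
  · simpa using hu.const_mul (4 * I * z)
  · simpa using hu'.const_mul (4 * I * z)
  · rw [sub_eq_add_neg]
    exact (hΩ'.const_mul _).neg.const_add _

/-! ### Decay of the boundary values of the seed solution -/

/-- A function `f` with `f` and `t f` in `L²(ℝ₊)` is integrable: `f = (1 + i t) f · (1 + i t)⁻¹`. -/
lemma integrableOn_of_memLp_weight {f : ℝ → ℂ} (h : MemLp f 2 (volume.restrict (Ici 0)))
    (hw : MemLp (fun t : ℝ => (t : ℂ) * f t) 2 (volume.restrict (Ici 0))) :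
    IntegrableOn f (Ioi 0) := by
  have hne : ∀ t : ℝ, (1 + I * t : ℂ) ≠ 0 := fun t h0 => by
    have := congrArg Complex.re h0
    simp at this
  have h1 : MemLp (fun t : ℝ => (1 + I * t : ℂ)⁻¹) 2 (volume.restrict (Ici 0)) := by
    refine (memLp_two_iff_integrable_sq_norm ?_).2 ?_
    · exact (Continuous.inv₀ (by fun_prop) hne).aestronglyMeasurable
    · refine (integrable_inv_one_add_sq.restrict (s := Ici 0)).congr
        (Eventually.of_forall fun t => ?_)
      have : ‖(1 + I * t : ℂ)‖ ^ 2 = 1 + t ^ 2 := by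
        rw [← Complex.normSq_eq_norm_sq, Complex.normSq_apply]
        simp
        ring
      simp only [norm_inv, inv_pow, this]
  have h2 := (h.add (hw.const_mul I)).integrable_mul h1
  have h3 : IntegrableOn f (Ici 0) := by
    refine Integrable.congr h2 (Eventually.of_forall fun t => ?_)
    simp only [Pi.mul_apply, Pi.add_apply]
    field_simp [hne t]
  exact h3.mono_set Ioi_subset_Ici_self

lemma BoundaryInX.tendsto_zero {u : ℝ → ℝ → ℂ} (hu : IsNLSSolution u) (hX : BoundaryInX u) :
    Tendsto (fun t => u t 0) atTop (𝓝 0) := by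
  have hd : ∀ t ∈ Ioi (0 : ℝ), HasDerivAt (fun s => u s 0 * conj (u s 0))
      (dt u t 0 * conj (u t 0) + u t 0 * conj (dt u t 0)) t := fun t ht => by
    have h := (hu.diff_t t 0 (le_of_lt ht) le_rfl).hasDerivWithinAt.hasDerivAt (Ici_mem_nhds ht)
    exact h.mul h.star
  have i1 : IntegrableOn (fun s => u s 0 * conj (u s 0)) (Ioi 0) :=
    IntegrableOn.mono_set (t := Ici 0) (hX.memLp.integrable_mul hX.memLp.star) Ioi_subset_Ici_self
  have i2 : IntegrableOn (fun t => dt u t 0 * conj (u t 0) + u t 0 * conj (dt u t 0)) (Ioi 0) :=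
    IntegrableOn.mono_set (t := Ici 0) ((hX.memLp_dt.integrable_mul hX.memLp.star).add
      (hX.memLp.integrable_mul hX.memLp_dt.star)) Ioi_subset_Ici_self
  have h := (tendsto_zero_of_hasDerivAt_of_integrableOn_Ioi hd i2 i1).norm
  have h2 := (Real.continuous_sqrt.tendsto _).comp h
  rw [norm_zero, Real.sqrt_zero] at h2
  refine tendsto_zero_iff_norm_tendsto_zero.2 (h2.congr fun t => ?_)
  simp [Function.comp_def, ← pow_two]

lemma IsNewBoundary.tendsto_abs {α β : ℝ} {u : ℝ → ℝ → ℂ} {Ω : ℝ → ℝ}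
    (h : IsNewBoundary α β u Ω) (hu : Tendsto (fun t => u t 0) atTop (𝓝 0)) :
    Tendsto Ω atTop (𝓝 |β|) := by
  have h1 : Tendsto (fun t => Real.sqrt (β ^ 2 - ‖u t 0‖ ^ 2)) atTop (𝓝 |β|) := by
    have := (Real.continuous_sqrt.tendsto _).comp ((hu.norm.pow 2).const_sub (β ^ 2))
    simpa [Real.sqrt_sq_eq_abs, Function.comp_def] using this
  refine h1.congr' ?_
  filter_upwards [h.eventually_pos, eventually_ge_atTop (0 : ℝ)] with t h2 h3
  rw [← h.sq_eq t h3, Real.sqrt_sq h2.le]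

lemma lineProj_diag_mem_Icc {v : Fin 2 → ℂ} : (lineProj v 0 0).re ∈ Icc (0 : ℝ) 1 ∧
    ‖lineProj v 0 1‖ ^ 2 = (lineProj v 0 0).re - (lineProj v 0 0).re ^ 2 := by
  have h := lineProj_normSq_offDiag v
  rw [← norm_sq_eq_mul_conj, ← lineProj_diag_re v 0] at h
  have h' : ‖lineProj v 0 1‖ ^ 2 = (lineProj v 0 0).re - (lineProj v 0 0).re ^ 2 := by
    exact_mod_cast h
  have := sq_nonneg ‖lineProj v 0 1‖
  refine ⟨⟨?_, ?_⟩, h'⟩ <;> nlinarith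

/-- The line of a Lax solution at `x = 0` converges to a coordinate axis if the boundary values of
the potential are integrable: the diagonal entry of its projector solves a logistic equation with
rate `8 Im (m²)`, perturbed by terms that are linear in the boundary values. -/
theorem exists_asympDir {u : ℝ → ℝ → ℂ} {m : ℂ} {φ : ℝ → ℝ → Fin 2 → ℂ} (hu : IsNLSSolution u)
    (hφ : IsLaxSolution u m φ) (h0 : ∀ t x : ℝ, 0 ≤ t → 0 ≤ x → φ t x ≠ 0)
    (hi : IntegrableOn (fun t => u t 0) (Ioi 0)) (hix : IntegrableOn (fun t => dx u t 0) (Ioi 0))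
    (him : m.im ≠ 0) (hre : m.re ≠ 0) : ∃ s, AsympDir (fun t => φ t 0) s := by
  set p : ℝ → ℝ := fun t => (lineProj (φ t 0) 0 0).re with hp
  set f : ℝ → ℂ := fun t => (2 * m * u t 0 + I * dx u t 0) * conj (lineProj (φ t 0) 0 1)
    + (2 * conj m * conj (u t 0) - I * conj (dx u t 0)) * lineProj (φ t 0) 0 1
    - 2 * (m - conj m) * (u t 0 * conj (lineProj (φ t 0) 0 1)
        - conj (u t 0) * lineProj (φ t 0) 0 1) * lineProj (φ t 0) 0 0 with hf
  have c1 := continuousOn_t_of_quadrant hu.cont (x := 0) le_rfl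
  have c2 := continuous_conj.comp_continuousOn c1
  have c3 := continuousOn_t_of_quadrant hu.cont_x (x := 0) le_rfl
  have c4 := continuous_conj.comp_continuousOn c3
  have c5 := continuousOn_t_of_quadrant (f := fun t x => lineProj (φ t x) 0 0)
    (continuousOn_lineProj hφ h0 0 0) (x := 0) le_rfl
  have c6 := continuousOn_t_of_quadrant (f := fun t x => lineProj (φ t x) 0 1)
    (continuousOn_lineProj hφ h0 0 1) (x := 0) le_rfl
  have c7 := continuous_conj.comp_continuousOn c6
  simp only [Function.comp_def] at c2 c4 c7
  have hfc : ContinuousOn f (Ici 0) := by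
    rw [hf]
    fun_prop
  have hb1 : ∀ t, ‖lineProj (φ t 0) 0 1‖ ≤ 1 := fun t => by
    have h := lineProj_diag_mem_Icc (v := φ t 0)
    nlinarith [h.1.1, h.1.2, h.2, norm_nonneg (lineProj (φ t 0) 0 1)]
  have hp1 : ∀ t, ‖lineProj (φ t 0) 0 0‖ ≤ 1 := fun t => by
    have h := (lineProj_diag_mem_Icc (v := φ t 0)).1
    rw [← lineProj_diag_re, Complex.norm_real, Real.norm_eq_abs, abs_of_nonneg h.1]
    exact h.2
  have hfb : ∀ t, ‖f t‖ ≤ 12 * ‖m‖ * ‖u t 0‖ + 2 * ‖dx u t 0‖ := fun t => by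
    have n1 : ‖(2 * m * u t 0 + I * dx u t 0) * conj (lineProj (φ t 0) 0 1)‖
        ≤ 2 * ‖m‖ * ‖u t 0‖ + ‖dx u t 0‖ := by
      rw [norm_mul, Complex.norm_conj]
      refine (mul_le_of_le_one_right (norm_nonneg _) (hb1 t)).trans ?_
      refine (norm_add_le _ _).trans ?_
      simp
    have n2 : ‖(2 * conj m * conj (u t 0) - I * conj (dx u t 0)) * lineProj (φ t 0) 0 1‖
        ≤ 2 * ‖m‖ * ‖u t 0‖ + ‖dx u t 0‖ := by
      rw [norm_mul]
      refine (mul_le_of_le_one_right (norm_nonneg _) (hb1 t)).trans ?_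
      refine (norm_sub_le _ _).trans ?_
      simp
    have n3 : ‖u t 0 * conj (lineProj (φ t 0) 0 1) - conj (u t 0) * lineProj (φ t 0) 0 1‖
        ≤ 2 * ‖u t 0‖ := by
      refine (norm_sub_le _ _).trans ?_
      rw [norm_mul, norm_mul, Complex.norm_conj, Complex.norm_conj]
      have := mul_le_of_le_one_right (norm_nonneg (u t 0)) (hb1 t)
      linarith
    have n4 : ‖2 * (m - conj m)‖ ≤ 4 * ‖m‖ := by
      rw [norm_mul]
      have := norm_sub_le m (conj m)
      rw [Complex.norm_conj] at this
      simp
      linarith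
    have n5 : ‖2 * (m - conj m) * (u t 0 * conj (lineProj (φ t 0) 0 1)
        - conj (u t 0) * lineProj (φ t 0) 0 1) * lineProj (φ t 0) 0 0‖
        ≤ 4 * ‖m‖ * (2 * ‖u t 0‖) := by
      rw [norm_mul]
      refine (mul_le_of_le_one_right (norm_nonneg _) (hp1 t)).trans ?_
      rw [norm_mul]
      exact mul_le_mul n4 n3 (norm_nonneg _) (by positivity)
    refine (norm_sub_le _ _).trans ((add_le_add (norm_add_le _ _) le_rfl).trans ?_)
    linarith
  have hfi : IntegrableOn f (Ioi 0) := by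
    refine Integrable.mono' ((hi.norm.const_mul (12 * ‖m‖)).add (hix.norm.const_mul 2))
      ((hfc.mono Ioi_subset_Ici_self).aestronglyMeasurable measurableSet_Ioi)
      (Eventually.of_forall fun t => hfb t)
  have hK : 8 * (m ^ 2).im ≠ 0 := by
    rw [pow_two, Complex.mul_im]
    have := mul_ne_zero hre him
    intro h
    exact this (by linarith)
  have hd : ∀ t, 0 ≤ t → HasDerivWithinAt p (8 * (m ^ 2).im * (p t - p t ^ 2) + (f t).re)
      (Ici 0) t := fun t ht => by
    have h := hasDerivWithinAt_diag_t hφ ht le_rfl (h0 t 0 ht le_rfl)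
    have h' : HasDerivWithinAt p (diagDt u m φ t 0).re (Ici 0) t :=
      Complex.reCLM.hasFDerivAt.comp_hasDerivWithinAt t h
    refine h'.congr_deriv ?_
    have e1 : m ^ 2 - conj m ^ 2 = ((2 * (m ^ 2).im : ℝ) : ℂ) * I := by
      rw [← map_pow, Complex.sub_conj]
    have e2 : diagDt u m φ t 0 = ((8 * (m ^ 2).im * (p t - p t ^ 2) : ℝ) : ℂ) + f t := by
      simp only [diagDt, hf, e1]
      rw [← lineProj_diag_re (φ t 0) 0]
      push_cast
      linear_combination (-8 * ((m ^ 2).im : ℂ) * (p t - p t ^ 2)) * I_mul_I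
    rw [e2, Complex.add_re, Complex.ofReal_re]
  have key := tendsto_of_perturbed_logistic hK
    (fun t _ => (lineProj_diag_mem_Icc (v := φ t 0)).1) hd
    (Complex.continuous_re.comp_continuousOn hfc) hfi.re
  -- convergence of the diagonal entry to an idempotent limit gives convergence of the projector
  have hfinish : ∀ a : ℝ, a - a ^ 2 = 0 → Tendsto p atTop (𝓝 a) →
      Tendsto (fun t => lineProj (φ t 0)) atTop (𝓝 !![(a : ℂ), 0; 0, 1 - (a : ℂ)]) := by
    intro a ha hpa
    have t0 : Tendsto (fun t => lineProj (φ t 0) 0 0) atTop (𝓝 (a : ℂ)) :=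
      ((continuous_ofReal.tendsto a).comp hpa).congr fun t => lineProj_diag_re _ _
    have t1 : Tendsto (fun t => lineProj (φ t 0) 0 1) atTop (𝓝 0) := by
      have h1 := (Real.continuous_sqrt.tendsto _).comp (hpa.sub (hpa.pow 2))
      rw [ha, Real.sqrt_zero] at h1
      refine tendsto_zero_iff_norm_tendsto_zero.2 (h1.congr fun t => ?_)
      rw [Function.comp_def]
      dsimp only
      rw [← (lineProj_diag_mem_Icc (v := φ t 0)).2, Real.sqrt_sq (norm_nonneg _)]
    rw [tendsto_matrix_iff]
    intro i j
    fin_cases i <;> fin_cases j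
    · exact t0
    · exact t1
    · have := (continuous_conj.tendsto 0).comp t1
      rw [map_zero] at this
      exact this.congr fun t => (lineProj_one_zero _).symm
    · refine (t0.const_sub 1).congr' ?_
      filter_upwards [eventually_ge_atTop (0 : ℝ)] with t ht
      exact (lineProj_one_one (h0 t 0 ht le_rfl)).symm
  rcases key with k | k
  · refine ⟨1, ?_⟩
    rw [AsympDir]
    convert hfinish 0 (by norm_num) k using 2
    ext i j
    fin_cases i <;> fin_cases j <;> simp [Matrix.single_apply]
  · refine ⟨0, ?_⟩
    rw [AsympDir]
    convert hfinish 1 (by norm_num) k using 2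
    ext i j
    fin_cases i <;> fin_cases j <;> simp [Matrix.single_apply]

/-! ### Iterated Darboux transformations -/

/-- The image `D[n](μ_k) φ_k` of the `k`-th Lax solution under the `n`-fold Darboux matrix. -/
def dressedSol (μ : ℕ → ℂ) (φ : ℕ → ℝ → ℝ → Fin 2 → ℂ) (n k : ℕ) (t x : ℝ) : Fin 2 → ℂ :=
  dressD μ (fun m => φ m t x) n (μ k) *ᵥ φ k t x

lemma dressedSol_zero (μ : ℕ → ℂ) (φ : ℕ → ℝ → ℝ → Fin 2 → ℂ) (k : ℕ) :
    dressedSol μ φ 0 k = φ k := by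
  funext t x
  simp [dressedSol, dressD]

lemma dressedSol_succ (μ : ℕ → ℂ) (φ : ℕ → ℝ → ℝ → Fin 2 → ℂ) (n k : ℕ) :
    dressedSol μ φ (n + 1) k
      = fun t x => darbouxF (μ n) (dressedSol μ φ n n t x) (μ k) *ᵥ dressedSol μ φ n k t x := by
  funext t x
  rw [dressedSol, dressD_succ, ← Matrix.mulVec_mulVec]
  rfl

lemma dressU_zero (u : ℝ → ℝ → ℂ) (μ : ℕ → ℂ) (φ : ℕ → ℝ → ℝ → Fin 2 → ℂ) :
    dressU u μ φ 0 = u := by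
  funext t x
  simp [dressU, dressQ, potQ]

lemma dressU_succ (u : ℝ → ℝ → ℂ) (μ : ℕ → ℂ) (φ : ℕ → ℝ → ℝ → Fin 2 → ℂ) (n : ℕ) :
    dressU u μ φ (n + 1) = darbouxU (dressU u μ φ n) (μ n) (dressedSol μ φ n n) := by
  funext t x
  have e : dressVec μ (fun k => φ k t x) n = dressedSol μ φ n n t x := rfl
  rw [darbouxU, dressU, dressU, dressQ, dressQ, Finset.sum_range_succ, smul_add, ← sub_sub, e]
  simp only [Matrix.sub_apply _ (I • _), Matrix.smul_apply, Matrix.sub_apply, Matrix.mul_apply,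
    Fin.sum_univ_two, sigma3, smul_eq_mul]
  simp
  ring

/-- The iterated Darboux transform solves the NLS equation, and the Darboux matrices map Lax
solutions of the seed to Lax solutions of the transform. -/
lemma isNLSSolution_dressU {u : ℝ → ℝ → ℂ} {μ : ℕ → ℂ} {φ : ℕ → ℝ → ℝ → Fin 2 → ℂ} {m : ℕ}
    (hu : IsNLSSolution u) (hφ : ∀ k < m, IsLaxSolution u (μ k) (φ k))
    (h0 : ∀ k < m, ∀ n ≤ k, ∀ t x : ℝ, 0 ≤ t → 0 ≤ x → dressedSol μ φ n k t x ≠ 0) :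
    ∀ n ≤ m, IsNLSSolution (dressU u μ φ n) ∧
      ∀ k < m, n ≤ k → IsLaxSolution (dressU u μ φ n) (μ k) (dressedSol μ φ n k) := by
  intro n
  induction n with
  | zero =>
    intro _
    rw [dressU_zero]
    exact ⟨hu, fun k hk _ => (dressedSol_zero μ φ k).symm ▸ hφ k hk⟩
  | succ n ih =>
    intro hn
    obtain ⟨h1, h2⟩ := ih (by omega)
    have h3 := h2 n hn le_rfl
    have h4 := h0 n hn n le_rfl
    rw [dressU_succ]
    refine ⟨isNLSSolution_darbouxU h1 h3 h4, fun k hk hnk => ?_⟩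
    rw [dressedSol_succ]
    exact IsLaxSolution.darbouxF_mulVec h1 h3 h4 (h2 k hk (by omega))

lemma pairParam_two_mul (lam : ℕ → ℂ) (j : ℕ) : pairParam lam (2 * j) = lam j := by
  simp [pairParam]

lemma pairParam_two_mul_add_one (lam : ℕ → ℂ) (j : ℕ) :
    pairParam lam (2 * j + 1) = -lam j := by
  have h : (2 * j + 1) / 2 = j := by omega
  simp [pairParam, h]

lemma pairSol_two_mul (ψ ψhat : ℕ → ℝ → ℝ → Fin 2 → ℂ) (j : ℕ) :
    pairSol ψ ψhat (2 * j) = ψ j := by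
  simp [pairSol]

lemma pairSol_two_mul_add_one (ψ ψhat : ℕ → ℝ → ℝ → Fin 2 → ℂ) (j : ℕ) :
    pairSol ψ ψhat (2 * j + 1) = ψhat j := by
  have h : (2 * j + 1) / 2 = j := by omega
  simp [pairSol, h]

/-! ### Admissible spectral parameters -/

/-- The left side is the determinant of the numerator of the boundary matrix; its roots are the four
exceptional parameters. -/
lemma bdryL_det_ne_zero {α β : ℝ} {z : ℂ} (h1 : z ≠ specialParam α β)
    (h2 : z ≠ conj (specialParam α β)) (h3 : z ≠ -specialParam α β)
    (h4 : z ≠ -conj (specialParam α β)) :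
    (4 * z ^ 2 - ((α ^ 2 + β ^ 2 : ℝ) : ℂ)) ^ 2 + 16 * z ^ 2 * ((β ^ 2 : ℝ) : ℂ) ≠ 0 := by
  have e : (4 * z ^ 2 - ((α ^ 2 + β ^ 2 : ℝ) : ℂ)) ^ 2 + 16 * z ^ 2 * ((β ^ 2 : ℝ) : ℂ)
      = 16 * ((z - specialParam α β) * (z - -specialParam α β)
        * ((z - conj (specialParam α β)) * (z - -conj (specialParam α β)))) := by
    have hI : I ^ 2 = -1 := I_sq
    simp only [specialParam, map_div₀, map_neg, map_add, map_mul, conj_I, conj_ofReal, map_ofNat]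
    push_cast
    grind
  rw [e]
  simp only [ne_eq, mul_eq_zero, OfNat.ofNat_ne_zero, sub_eq_zero, false_or]
  tauto

lemma bdryL_det_eq_mul (α β : ℝ) (z : ℂ) :
    (4 * z ^ 2 - ((α ^ 2 + β ^ 2 : ℝ) : ℂ)) ^ 2 + 16 * z ^ 2 * ((β ^ 2 : ℝ) : ℂ)
      = ((2 * z - I * (|β| : ℝ)) ^ 2 - (α : ℂ) ^ 2)
        * ((2 * z + I * (|β| : ℝ)) ^ 2 - (α : ℂ) ^ 2) := by
  have hI : I ^ 2 = -1 := I_sq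
  have hb : ((|β| : ℝ) : ℂ) ^ 2 = (β : ℂ) ^ 2 := by
    rw [← ofReal_pow, sq_abs, ofReal_pow]
  push_cast
  grind

/-! ### Dressing by a pair of parameters `l, -l` -/

/-- A potential with a boundary matrix obeying the boundary evolution, whose boundary values have
the limits that the decay of `u` enforces. -/
structure BdryState (α β : ℝ) (u : ℝ → ℝ → ℂ) (Ω : ℝ → ℝ) : Prop where
  sq_add : ∀ t, 0 ≤ t → Ω t ^ 2 + ‖u t 0‖ ^ 2 = β ^ 2
  evolution : ∀ t, 0 ≤ t → BdryEvolution (α ^ 2 + β ^ 2) u Ω t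
  tendsto_u : Tendsto (fun t => u t 0) atTop (𝓝 0)
  tendsto_om : Tendsto Ω atTop (𝓝 |β|)

/-- A pair of vector functions related at `x = 0` by a multiple of the boundary matrix, the first
one with an asymptotic direction. -/
def IsBdryPair (c : ℝ) (u : ℝ → ℝ → ℂ) (Ω : ℝ → ℝ) (l : ℂ) (χ χhat : ℝ → ℝ → Fin 2 → ℂ) : Prop :=
  (∃ k : ℂ, k ≠ 0 ∧ ∀ t, 0 ≤ t → χhat t 0 = k • (bdryL c (bdryM (u t 0) (Ω t)) l *ᵥ χ t 0)) ∧
    ∃ s, AsympDir (fun t => χ t 0) s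

section PairStep

variable {α β : ℝ} {u : ℝ → ℝ → ℂ} {Ω : ℝ → ℝ} {l : ℂ} {φ φhat : ℝ → ℝ → Fin 2 → ℂ}

/-- Both vectors of a pair have the same asymptotic direction, since the boundary matrix becomes
diagonal. -/
lemma IsBdryPair.exists_asympDir (hS : BdryState α β u Ω)
    (hp : IsBdryPair (α ^ 2 + β ^ 2) u Ω l φ φhat) (h0 : ∀ t, 0 ≤ t → φ t 0 ≠ 0)
    (hdet : (4 * l ^ 2 - ((α ^ 2 + β ^ 2 : ℝ) : ℂ)) ^ 2 + 16 * l ^ 2 * ((β ^ 2 : ℝ) : ℂ) ≠ 0)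
    (hl0 : l ≠ 0) :
    ∃ s, AsympDir (fun t => φ t 0) s ∧
      AsympDir (fun t => darbouxF l (φ t 0) (-l) *ᵥ φhat t 0) s := by
  obtain ⟨⟨k, hk, hpk⟩, s, hs⟩ := hp
  refine ⟨s, hs, ?_⟩
  have hM : ∀ t, 0 ≤ t → bdryM (u t 0) (Ω t) * bdryM (u t 0) (Ω t)
      = ((β ^ 2 : ℝ) : ℂ) • (1 : Matrix (Fin 2) (Fin 2) ℂ) := fun t ht => by
    rw [bdryM_mul_self, hS.sq_add t ht]
  have hL0 : ∀ t, 0 ≤ t → bdryL (α ^ 2 + β ^ 2) (bdryM (u t 0) (Ω t)) l *ᵥ φ t 0 ≠ 0 :=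
    fun t ht => bdryL_mulVec_ne_zero (hM t ht) hdet (h0 t ht)
  have hb : ((|β| : ℝ) : ℂ) ^ 2 = ((β ^ 2 : ℝ) : ℂ) := by rw [← ofReal_pow, sq_abs]
  -- the determinant is the product of the limits of the diagonal entries
  have hprod : (4 * l ^ 2 - ((α ^ 2 + β ^ 2 : ℝ) : ℂ) + 4 * I * l * (|β| : ℝ))
      * (4 * l ^ 2 - ((α ^ 2 + β ^ 2 : ℝ) : ℂ) - 4 * I * l * (|β| : ℝ)) ≠ 0 := by
    refine fun h => hdet ?_
    rw [← hb]
    linear_combination h + (16 * l ^ 2 * ((|β| : ℝ) : ℂ) ^ 2) * I_mul_I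
  have h1 := hs.mulVec h0 (tendsto_bdryL hS.tendsto_u hS.tendsto_om (α ^ 2 + β ^ 2) l) (by
    fin_cases s
    · exact left_ne_zero_of_mul hprod
    · exact right_ne_zero_of_mul hprod)
  have h2 := h1.mulVec hL0 (hs.tendsto_darbouxF l (-l)) (by
    rw [if_pos rfl]
    exact fun h => hl0 (by linear_combination (-1 / 2 : ℂ) * h))
  refine h2.congr fun t ht => ?_
  rw [hpk t ht, Matrix.mulVec_smul, lineProj_smul hk]

/-- Dressing by a pair preserves the boundary structure, limits included: the two projectors have
the same limit, and their contributions to the limits of `u` and `Ω` cancel. -/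
theorem BdryState.pair (hS : BdryState α β u Ω) (hu : IsNLSSolution u)
    (hp : IsBdryPair (α ^ 2 + β ^ 2) u Ω l φ φhat)
    (hφ : IsLaxSolution u l φ) (h0 : ∀ t x : ℝ, 0 ≤ t → 0 ≤ x → φ t x ≠ 0)
    {φ₁ : ℝ → ℝ → Fin 2 → ℂ} (e₁ : φ₁ = fun t x => darbouxF l (φ t x) (-l) *ᵥ φhat t x)
    (hφ₁ : IsLaxSolution (darbouxU u l φ) (-l) φ₁)
    (h₁ : ∀ t x : ℝ, 0 ≤ t → 0 ≤ x → φ₁ t x ≠ 0)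
    (hdet : (4 * l ^ 2 - ((α ^ 2 + β ^ 2 : ℝ) : ℂ)) ^ 2 + 16 * l ^ 2 * ((β ^ 2 : ℝ) : ℂ) ≠ 0)
    (hl0 : l ≠ 0) (hre : -l ≠ conj l) (him : l.im ≠ 0) :
    BdryState α β (darbouxU (darbouxU u l φ) (-l) φ₁) (pairOm Ω l φ φ₁) ∧
    ∀ (z : ℂ) (χ χhat : ℝ → ℝ → Fin 2 → ℂ), z ≠ l → z ≠ -l →
      IsBdryPair (α ^ 2 + β ^ 2) u Ω z χ χhat → (∀ t, 0 ≤ t → χ t 0 ≠ 0) →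
      (∀ t, 0 ≤ t → darbouxF l (φ t 0) z *ᵥ χ t 0 ≠ 0) →
      (∀ t, 0 ≤ t → darbouxF (-l) (φ₁ t 0) z *ᵥ (darbouxF l (φ t 0) z *ᵥ χ t 0) ≠ 0) →
      IsBdryPair (α ^ 2 + β ^ 2) (darbouxU (darbouxU u l φ) (-l) φ₁) (pairOm Ω l φ φ₁) z
        (fun t x => darbouxF (-l) (φ₁ t x) z *ᵥ (darbouxF l (φ t x) z *ᵥ χ t x))
        (fun t x => darbouxF (-l) (φ₁ t x) (-z) *ᵥ (darbouxF l (φ t x) (-z) *ᵥ χhat t x)) := by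
  have h00 : ∀ t, 0 ≤ t → φ t 0 ≠ 0 := fun t ht => h0 t 0 ht le_rfl
  obtain ⟨s, hs, hs₁⟩ := hp.exists_asympDir hS h00 hdet hl0
  have hs₁' : AsympDir (fun t => φ₁ t 0) s := by rw [e₁]; exact hs₁
  obtain ⟨⟨k, hk, hpk⟩, -⟩ := hp
  have hφ₁e : ∀ t, 0 ≤ t →
      φ₁ t 0 = k • pairVec (α ^ 2 + β ^ 2) (bdryM (u t 0) (Ω t)) l (φ t 0) := fun t ht => by
    rw [e₁]
    simp only
    rw [hpk t ht, Matrix.mulVec_smul, pairVec]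
  have hM : ∀ t, 0 ≤ t → bdryM (u t 0) (Ω t) * bdryM (u t 0) (Ω t)
      = ((β ^ 2 : ℝ) : ℂ) • (1 : Matrix (Fin 2) (Fin 2) ℂ) := fun t ht => by
    rw [bdryM_mul_self, hS.sq_add t ht]
  have hM₂ : ∀ t, 0 ≤ t → pairM (α ^ 2 + β ^ 2) (bdryM (u t 0) (Ω t)) l (φ t 0)
      = bdryM (darbouxU (darbouxU u l φ) (-l) φ₁ t 0) (pairOm Ω l φ φ₁ t) := fun t ht =>
    pairM_bdryM (h00 t ht) (h₁ t 0 ht le_rfl) (by rw [hφ₁e t ht, lineProj_smul hk])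
  have hlim : ∀ i j, Tendsto (fun t => lineProj (φ t 0) i j - lineProj (φ₁ t 0) i j) atTop
      (𝓝 0) := fun i j => by
    simpa using (tendsto_matrix_iff.1 hs i j).sub (tendsto_matrix_iff.1 hs₁' i j)
  refine ⟨⟨fun t ht => ?_, fun t ht => ?_, ?_, ?_⟩, ?_⟩
  · have h := pairM_mul_self (hM t ht) (conjTranspose_bdryM _ _) hdet (h00 t ht) hl0 hre him
    rw [hM₂ t ht, bdryM_mul_self] at h
    have h' := congrFun (congrFun h 0) 0
    simp only [Matrix.smul_apply, Matrix.one_apply_eq, smul_eq_mul, mul_one] at h'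
    exact_mod_cast h'
  · exact bdryEvolution_pair hu hφ h0 hφ₁ h₁ hk hφ₁e hS.sq_add hdet hl0 hre him hS.evolution ht
  · have h := hS.tendsto_u.sub ((hlim 0 1).const_mul (2 * I * (l - conj l)))
    rw [mul_zero, sub_zero] at h
    refine h.congr fun t => ?_
    simp only [darbouxU, map_neg]
    ring
  · have h := ((Complex.continuous_re.tendsto 0).comp (hlim 0 0)).const_mul (4 * l.im)
    rw [zero_re, mul_zero] at h
    have h' := hS.tendsto_om.add h
    rw [add_zero] at h'
    exact h'.congr fun t => by simp [pairOm]
  · rintro z χ χhat hz1 hz2 ⟨⟨k', hk', hpk'⟩, r, hr⟩ hχ0 hχ1 hχ2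
    refine ⟨⟨k', hk', fun t ht => ?_⟩, ?_⟩
    · have h := bdryL_pairM_mul (hM t ht) (conjTranspose_bdryM _ _) hdet (h00 t ht) hl0 hre z
      rw [hM₂ t ht] at h
      have h' := congrArg (fun X => X *ᵥ χ t 0) h
      simp only [pairG, ← Matrix.mulVec_mulVec] at h'
      simp only [hφ₁e t ht, darbouxF_smul hk]
      rw [h', hpk' t ht, Matrix.mulVec_smul, Matrix.mulVec_smul]
    · obtain ⟨q, hq⟩ := hs.darbouxF_mulVec hr hχ0 hz1 hχ1
      exact hs₁'.darbouxF_mulVec hq hχ1 hz2 hχ2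

end PairStep

/-- The branch of `Ω` is the nonnegative square root on final intervals where it does not vanish,
by continuity and positivity for large times. -/
lemma IsNewBoundary.eq_sqrt {α β : ℝ} {u : ℝ → ℝ → ℂ} {Ω : ℝ → ℝ} (h : IsNewBoundary α β u Ω)
    (hev : ∀ t, 0 ≤ t → BdryEvolution (α ^ 2 + β ^ 2) u Ω t) {T : ℝ} (hT : 0 ≤ T)
    (hlt : ∀ t, T ≤ t → ‖u t 0‖ < |β|) {t : ℝ} (ht : T ≤ t) :
    Ω t = Real.sqrt (β ^ 2 - ‖u t 0‖ ^ 2) := by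
  have hc : ContinuousOn Ω (Ici 0) := fun s hs =>
    (Complex.continuous_re.continuousAt.comp_continuousWithinAt
      (hev s hs 0 0).continuousWithinAt : ContinuousWithinAt _ _ _)
  have hne : ∀ s, T ≤ s → Ω s ≠ 0 := fun s hs h0 => by
    have h1 := h.sq_eq s (hT.trans hs)
    rw [h0, ← sq_abs β] at h1
    have h2 := hlt s hs
    nlinarith [norm_nonneg (u s 0)]
  have hpos : 0 < Ω t := by
    by_contra hneg
    have hneg' : Ω t ≤ 0 := not_lt.1 hneg
    obtain ⟨s, hs, hts⟩ := (h.eventually_pos.and (eventually_ge_atTop t)).exists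
    obtain ⟨r, hr, hr0⟩ := intermediate_value_Icc hts
      (hc.mono fun y hy => (hT.trans ht).trans hy.1) ⟨hneg', hs.le⟩
    exact hne r (ht.trans hr.1) hr0
  rw [← h.sq_eq t (hT.trans ht), Real.sqrt_sq hpos.le]

/-! ### Induction over the pairs -/

section Induction

variable {α β : ℝ} {u : ℝ → ℝ → ℂ} {Ω : ℝ → ℝ} {N : ℕ} {lam : ℕ → ℂ} {φ : ℕ → ℝ → ℝ → Fin 2 → ℂ}

/-- After `n` pair steps the boundary structure is preserved, and the remaining pairs of dressed
solutions are still related by the current boundary matrix. -/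
lemma exists_bdryState (hS : BdryState α β u Ω) (hu : IsNLSSolution u)
    (hφ : ∀ k < 2 * N, IsLaxSolution u (pairParam lam k) (φ k))
    (h0 : ∀ k < 2 * N, ∀ n ≤ k, ∀ t x : ℝ, 0 ≤ t → 0 ≤ x →
      dressedSol (pairParam lam) φ n k t x ≠ 0)
    (hp : ∀ j < N, IsBdryPair (α ^ 2 + β ^ 2) u Ω (lam j) (φ (2 * j)) (φ (2 * j + 1)))
    (hdet : ∀ j < N, (4 * lam j ^ 2 - ((α ^ 2 + β ^ 2 : ℝ) : ℂ)) ^ 2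
      + 16 * lam j ^ 2 * ((β ^ 2 : ℝ) : ℂ) ≠ 0)
    (him : ∀ j < N, (lam j).im ≠ 0) (hre : ∀ j < N, (lam j).re ≠ 0)
    (hdist : ∀ j < N, ∀ k < N, j ≠ k → lam j ≠ lam k)
    (hdist' : ∀ j < N, ∀ k < N, -lam k ≠ lam j) :
    ∀ n ≤ N, ∃ Ωn : ℝ → ℝ, BdryState α β (dressU u (pairParam lam) φ (2 * n)) Ωn ∧
      ∀ j < N, n ≤ j → IsBdryPair (α ^ 2 + β ^ 2) (dressU u (pairParam lam) φ (2 * n)) Ωn (lam j)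
        (dressedSol (pairParam lam) φ (2 * n) (2 * j))
        (dressedSol (pairParam lam) φ (2 * n) (2 * j + 1)) := by
  intro n
  induction n with
  | zero =>
    intro _
    refine ⟨Ω, ?_, fun j hj _ => ?_⟩
    · rw [mul_zero, dressU_zero]
      exact hS
    · rw [mul_zero, dressU_zero, dressedSol_zero, dressedSol_zero]
      exact hp j hj
  | succ n ih =>
    intro hn
    obtain ⟨Ωn, hSn, hpn⟩ := ih (by omega)
    have hD := isNLSSolution_dressU hu hφ h0
    obtain ⟨hu0, hL0⟩ := hD (2 * n) (by omega)
    obtain ⟨-, hL1⟩ := hD (2 * n + 1) (by omega)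
    have hl0 : lam n ≠ 0 := fun h => him n hn (by rw [h]; rfl)
    have hre' : -lam n ≠ conj (lam n) := fun h => by
      have h' := congrArg Complex.re h
      rw [neg_re, conj_re] at h'
      exact hre n hn (by linarith)
    have a0 := hL0 (2 * n) (by omega) le_rfl
    have a1 := hL1 (2 * n + 1) (by omega) le_rfl
    rw [dressU_succ, pairParam_two_mul_add_one, pairParam_two_mul] at a1
    rw [pairParam_two_mul] at a0
    have e1 := dressedSol_succ (pairParam lam) φ (2 * n) (2 * n + 1)
    rw [pairParam_two_mul_add_one, pairParam_two_mul] at e1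
    obtain ⟨hS2, hP2⟩ := hSn.pair hu0 (hpn n hn le_rfl) a0 (h0 (2 * n) (by omega) _ le_rfl) e1 a1
      (h0 (2 * n + 1) (by omega) _ le_rfl) (hdet n hn) hl0 hre' (him n hn)
    have eU : dressU u (pairParam lam) φ (2 * (n + 1))
        = darbouxU (darbouxU (dressU u (pairParam lam) φ (2 * n)) (lam n)
          (dressedSol (pairParam lam) φ (2 * n) (2 * n))) (-lam n)
          (dressedSol (pairParam lam) φ (2 * n + 1) (2 * n + 1)) := by
      rw [show 2 * (n + 1) = 2 * n + 1 + 1 by ring, dressU_succ, dressU_succ,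
        pairParam_two_mul_add_one, pairParam_two_mul]
    have eS : ∀ k, dressedSol (pairParam lam) φ (2 * n + 1) k = fun t x =>
        darbouxF (lam n) (dressedSol (pairParam lam) φ (2 * n) (2 * n) t x) (pairParam lam k)
          *ᵥ dressedSol (pairParam lam) φ (2 * n) k t x := fun k => by
      rw [dressedSol_succ, pairParam_two_mul]
    have eS2 : ∀ k, dressedSol (pairParam lam) φ (2 * (n + 1)) k = fun t x =>
        darbouxF (-lam n) (dressedSol (pairParam lam) φ (2 * n + 1) (2 * n + 1) t x)
          (pairParam lam k) *ᵥ
          (darbouxF (lam n) (dressedSol (pairParam lam) φ (2 * n) (2 * n) t x) (pairParam lam k)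
            *ᵥ dressedSol (pairParam lam) φ (2 * n) k t x) := fun k => by
      rw [show 2 * (n + 1) = 2 * n + 1 + 1 by ring, dressedSol_succ, pairParam_two_mul_add_one,
        eS k]
    refine ⟨_, eU ▸ hS2, fun j hj hnj => ?_⟩
    have b0 := h0 (2 * j) (by omega) (2 * n) (by omega)
    have b1 := h0 (2 * j) (by omega) (2 * n + 1) (by omega)
    have b2 := h0 (2 * j) (by omega) (2 * (n + 1)) (by omega)
    rw [eS] at b1
    rw [eS2] at b2
    rw [eU, eS2, eS2, pairParam_two_mul, pairParam_two_mul_add_one]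
    rw [pairParam_two_mul] at b1 b2
    exact hP2 (lam j) _ _ (hdist j hj n hn (by omega)) (hdist' j hj n hn).symm
      (hpn j hj (by omega)) (fun t ht => b0 t 0 ht le_rfl) (fun t ht => b1 t 0 ht le_rfl)
      (fun t ht => b2 t 0 ht le_rfl)

end Induction

end NLSHalfLine

end

theorem mainTheorem1
    (α β : ℝ) (hα : α ≠ 0) (hβ : β ≠ 0)
    (u : ℝ → ℝ → ℂ) (Ω : ℝ → ℝ)
    (hu : NLSHalfLine.IsNLSSolution u)
    (hbc : NLSHalfLine.IsNewBoundary α β u Ω)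
    (hX : NLSHalfLine.BoundaryInX u)
    (N : ℕ) (lam : ℕ → ℂ) (ψ ψhat : ℕ → ℝ → ℝ → Fin 2 → ℂ)
    (hlam : ∀ j < N, (lam j).im ≠ 0 ∧ (lam j).re ≠ 0 ∧
      lam j ≠ NLSHalfLine.specialParam α β ∧
      lam j ≠ conj (NLSHalfLine.specialParam α β) ∧
      lam j ≠ -NLSHalfLine.specialParam α β ∧
      lam j ≠ -conj (NLSHalfLine.specialParam α β))
    (hdist : ∀ j < N, ∀ k < N, j ≠ k → lam j ≠ lam k)
    (hdist' : ∀ j < N, ∀ k < N, -lam k ≠ lam j)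
    (hψ : ∀ j < N, NLSHalfLine.IsLaxSolution u (lam j) (ψ j))
    (hψ0 : ∀ j < N, ∃ t x : ℝ, 0 ≤ t ∧ 0 ≤ x ∧ ψ j t x ≠ 0)
    (hψhat : ∀ j < N, NLSHalfLine.IsLaxSolution u (-lam j) (ψhat j))
    (hpair : ∀ j < N, ∀ t : ℝ, 0 ≤ t →
      ψhat j t 0 = NLSHalfLine.bdryK α β (u t 0) (Ω t) (lam j) *ᵥ ψ j t 0)
    (hconj : ∀ k < 2 * N, ∀ l < 2 * N,
      NLSHalfLine.pairParam lam k = conj (NLSHalfLine.pairParam lam l) →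
      ∀ t x : ℝ, 0 ≤ t → 0 ≤ x →
        star (NLSHalfLine.pairSol ψ ψhat l t x) ⬝ᵥ NLSHalfLine.pairSol ψ ψhat k t x ≠ 0) :
    -- all projectors of the `2N`-fold Darboux transformation are well defined
    (∀ k < 2 * N, ∀ t x : ℝ, 0 ≤ t → 0 ≤ x →
      NLSHalfLine.dressVec (NLSHalfLine.pairParam lam)
        (fun m => NLSHalfLine.pairSol ψ ψhat m t x) k ≠ 0) ∧
    -- the dressed function solves the NLS equation on the half-line
    NLSHalfLine.IsNLSSolution
      (NLSHalfLine.dressU u (NLSHalfLine.pairParam lam) (NLSHalfLine.pairSol ψ ψhat) (2 * N)) ∧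
    -- it satisfies the same boundary condition, with a boundary matrix of the same form
    ∃ ΩN : ℝ → ℝ,
      NLSHalfLine.IsNewBoundary α β
        (NLSHalfLine.dressU u (NLSHalfLine.pairParam lam) (NLSHalfLine.pairSol ψ ψhat) (2 * N))
        ΩN ∧
      -- the branch is the nonnegative square root on every final interval where `|u[2N]| < |β|`
      ∀ T : ℝ, 0 ≤ T →
        (∀ t : ℝ, T ≤ t → ‖NLSHalfLine.dressU u (NLSHalfLine.pairParam lam)
          (NLSHalfLine.pairSol ψ ψhat) (2 * N) t 0‖ < |β|) →
        ∀ t : ℝ, T ≤ t → ΩN t = Real.sqrt (β ^ 2 - ‖NLSHalfLine.dressU u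
          (NLSHalfLine.pairParam lam) (NLSHalfLine.pairSol ψ ψhat) (2 * N) t 0‖ ^ 2) := by
  have hdet : ∀ j < N, (4 * lam j ^ 2 - ((α ^ 2 + β ^ 2 : ℝ) : ℂ)) ^ 2
      + 16 * lam j ^ 2 * ((β ^ 2 : ℝ) : ℂ) ≠ 0 := fun j hj => by
    obtain ⟨-, -, h1, h2, h3, h4⟩ := hlam j hj
    exact NLSHalfLine.bdryL_det_ne_zero h1 h2 h3 h4
  have hpole : ∀ j < N, ((2 * lam j - I * (|β| : ℝ)) ^ 2 - (α : ℂ) ^ 2)⁻¹ ≠ 0 := fun j hj => by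
    have h := hdet j hj
    rw [NLSHalfLine.bdryL_det_eq_mul] at h
    exact inv_ne_zero (left_ne_zero_of_mul h)
  have hM : ∀ t, 0 ≤ t → NLSHalfLine.bdryM (u t 0) (Ω t) * NLSHalfLine.bdryM (u t 0) (Ω t)
      = ((β ^ 2 : ℝ) : ℂ) • (1 : Matrix (Fin 2) (Fin 2) ℂ) := fun t ht => by
    rw [NLSHalfLine.bdryM_mul_self, hbc.sq_eq t ht, sub_add_cancel]
  -- the Lax solutions vanish nowhere
  have hψne : ∀ j < N, ∀ t x : ℝ, 0 ≤ t → 0 ≤ x → ψ j t x ≠ 0 := by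
    intro j hj t x ht hx h
    obtain ⟨t', x', ht', hx', h'⟩ := hψ0 j hj
    exact h' ((hψ j hj).eq_zero hu ht hx h ht' hx')
  have hψhatne : ∀ j < N, ∀ t x : ℝ, 0 ≤ t → 0 ≤ x → ψhat j t x ≠ 0 := by
    intro j hj t x ht hx h
    have h1 := (hψhat j hj).eq_zero hu ht hx h ht le_rfl
    rw [hpair j hj t ht, NLSHalfLine.bdryK_eq, Matrix.smul_mulVec] at h1
    exact smul_ne_zero (hpole j hj) (NLSHalfLine.bdryL_mulVec_ne_zero (hM t ht) (hdet j hj)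
      (hψne j hj t 0 ht le_rfl)) h1
  have hcases : ∀ k < 2 * N, ∃ j < N, k = 2 * j ∨ k = 2 * j + 1 := fun k hk =>
    ⟨k / 2, by omega, by omega⟩
  have hφne : ∀ k < 2 * N, ∀ t x : ℝ, 0 ≤ t → 0 ≤ x →
      NLSHalfLine.pairSol ψ ψhat k t x ≠ 0 := by
    intro k hk
    obtain ⟨j, hj, rfl | rfl⟩ := hcases k hk
    · rw [NLSHalfLine.pairSol_two_mul]
      exact hψne j hj
    · rw [NLSHalfLine.pairSol_two_mul_add_one]
      exact hψhatne j hj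
  have hφ : ∀ k < 2 * N, NLSHalfLine.IsLaxSolution u (NLSHalfLine.pairParam lam k)
      (NLSHalfLine.pairSol ψ ψhat k) := by
    intro k hk
    obtain ⟨j, hj, rfl | rfl⟩ := hcases k hk
    · rw [NLSHalfLine.pairSol_two_mul, NLSHalfLine.pairParam_two_mul]
      exact hψ j hj
    · rw [NLSHalfLine.pairSol_two_mul_add_one, NLSHalfLine.pairParam_two_mul_add_one]
      exact hψhat j hj
  have hinj : ∀ k < 2 * N, ∀ l < 2 * N, k ≠ l →
      NLSHalfLine.pairParam lam k ≠ NLSHalfLine.pairParam lam l := by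
    intro k hk l hl hkl
    obtain ⟨i, hi, rfl | rfl⟩ := hcases k hk <;> obtain ⟨j, hj, rfl | rfl⟩ := hcases l hl <;>
      simp only [NLSHalfLine.pairParam_two_mul, NLSHalfLine.pairParam_two_mul_add_one]
    · exact hdist i hi j hj (by omega)
    · exact (hdist' i hi j hj).symm
    · exact hdist' j hj i hi
    · exact fun h => hdist i hi j hj (by omega) (neg_injective h)
  have hreal : ∀ k < 2 * N, NLSHalfLine.pairParam lam k ≠ conj (NLSHalfLine.pairParam lam k) := by
    intro k hk h
    have h' := Complex.conj_eq_iff_im.1 h.symm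
    obtain ⟨j, hj, rfl | rfl⟩ := hcases k hk
    · rw [NLSHalfLine.pairParam_two_mul] at h'
      exact (hlam j hj).1 h'
    · rw [NLSHalfLine.pairParam_two_mul_add_one, Complex.neg_im, neg_eq_zero] at h'
      exact (hlam j hj).1 h'
  have hne : ∀ k < 2 * N, ∀ n ≤ k, ∀ t x : ℝ, 0 ≤ t → 0 ≤ x →
      NLSHalfLine.dressedSol (NLSHalfLine.pairParam lam) (NLSHalfLine.pairSol ψ ψhat) n k t x ≠ 0 :=
    fun k hk n hn t x ht hx => NLSHalfLine.dressD_mulVec_ne_zero _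
      (fun m => NLSHalfLine.pairSol ψ ψhat m t x) (2 * N) (fun k hk => hφne k hk t x ht hx) hinj
      hreal (fun k hk l hl h => hconj k hk l hl h t x ht hx) k hk n hn
  -- the boundary structure of the seed
  have hu0 := hX.tendsto_zero hu
  have hS : NLSHalfLine.BdryState α β u Ω :=
    ⟨fun t ht => by rw [hbc.sq_eq t ht, sub_add_cancel],
      fun t ht => NLSHalfLine.bdryEvolution_of_isNewBoundary hβ hbc ht, hu0, hbc.tendsto_abs hu0⟩
  have hP : ∀ j < N, NLSHalfLine.IsBdryPair (α ^ 2 + β ^ 2) u Ω (lam j)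
      (NLSHalfLine.pairSol ψ ψhat (2 * j)) (NLSHalfLine.pairSol ψ ψhat (2 * j + 1)) := by
    intro j hj
    rw [NLSHalfLine.pairSol_two_mul, NLSHalfLine.pairSol_two_mul_add_one]
    refine ⟨⟨_, hpole j hj, fun t ht => ?_⟩,
      NLSHalfLine.exists_asympDir hu (hψ j hj) (hψne j hj)
        (NLSHalfLine.integrableOn_of_memLp_weight hX.memLp hX.memLp_weight)
        (NLSHalfLine.integrableOn_of_memLp_weight hX.memLp_dx hX.memLp_dx_weight)
        (hlam j hj).1 (hlam j hj).2.1⟩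
    rw [hpair j hj t ht, NLSHalfLine.bdryK_eq, Matrix.smul_mulVec]
  obtain ⟨ΩN, hSN, -⟩ := NLSHalfLine.exists_bdryState hS hu hφ hne hP hdet
    (fun j hj => (hlam j hj).1) (fun j hj => (hlam j hj).2.1) hdist hdist' N le_rfl
  have hB : NLSHalfLine.IsNewBoundary α β (NLSHalfLine.dressU u (NLSHalfLine.pairParam lam)
      (NLSHalfLine.pairSol ψ ψhat) (2 * N)) ΩN :=
    ⟨fun t ht => by rw [← hSN.sq_add t ht, add_sub_cancel_right],
      hSN.tendsto_om.eventually_const_lt (abs_pos.2 hβ),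
      fun z _ t ht i j => (hSN.evolution t ht).constraint z i j⟩
  exact ⟨fun k hk t x ht hx => hne k hk k le_rfl t x ht hx,
    (NLSHalfLine.isNLSSolution_dressU hu hφ hne (2 * N) le_rfl).1, ΩN, hB,
    fun T hT hlt t ht => hB.eq_sqrt hSN.evolution hT hlt ht⟩
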